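/- Let $k\in\mathbb N\cup\{\infty\}$, $S_k=\{0,\dots,k\}$ (with $S_\infty=\mathbb N_0$), $\Lambda_N=\{1,\dots,N-1\}$ and $\Omega_N=S_k^{\Lambda_N}$. Let $p:\mathbb Z^2\to[0,\infty)$ be a jump kernel; let $b_{\rm bulk}:S_k^2\to[0,\infty)$ be non-decreasing in its first variable, non-increasing in its second variable, with $b_{\rm bulk}(n,m)=0$ if and only if $n=0$ or $m=k$; and let $b_{\rm influx}:\mathbb Z\times S_k\to[0,\infty)$ and $b_{\rm outflux}:S_k\times\mathbb Z\to[0,\infty)$ be bounded. For $\eta\in\Omega_N$ let $\eta^{x\to y}=\eta-\delta_x+\delta_y$ if $\eta(x)\neq 0$ and $\eta(y)\neq k$, $\eta^{x\uparrow}=\eta+\delta_x$ if $\eta(x)\ne k$, $\eta^{x\downarrow}=\eta-\delta_x$ if $\eta(x)\neq0$, and let each of them be $\eta$ otherwise. Define $$\mathcal L^N_{\rm bulk}f(\eta)=\sum_{x,y\in\Lambda_N}p(x,y)\,b_{\rm bulk}(\eta(x),\eta(y))\,\big(f(\eta^{x\to y})-f(\eta)\big),$$ $$\mathcal L^N_{\rm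 influx}f(\eta)=\sum_{x\notin\Lambda_N}\sum_{y\in\Lambda_N}p(x,y)\,b_{\rm influx}(x,\eta(y))\,\big(f(\eta^{y\uparrow})-f(\eta)\big),$$ $$\mathcal L^N_{\rm outflux}f(\eta)=\sum_{x\in\Lambda_N}\sum_{y\notin\Lambda_N}p(x,y)\,b_{\rm outflux}(\eta(x),y)\,\big(f(\eta^{x\downarrow})-f(\eta)\big).$$ Let $\kappa(N),\theta(N)>0$ with $\theta(N)\to0$ and $$\kappa(N)\,\theta(N)\sum_{x\in\Lambda_N,\,y\notin\Lambda_N}\big(p(x,y)+p(y,x)\big)=o(N)\qquad(N\to\infty).$$ For each $N$ let $X^N$ and $Y^N$ be càdlàg $\Omega_N$-valued Markov processes on $[0,\infty)$ with generators $\mathcal L^N_{\rm bulk}$ (impermeable boundaries) and $\mathcal L^N_{\rm bulk}+\theta(N)(\mathcal L^N_{\rm influx}+\mathcal L^N_{\rm outflux})$ (weak reservoirs), respectively, with the same initial distribution. Let $\pi^N(\eta)=\frac1{N-1}\sum_{x\in\Lambda_N}\eta(x)\delta_{x/N}$, a finite measure on $[0,1]$. Then, for every $T>0$, the laws of the sped-up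 processes $(\pi^N(Y^N_{\kappa(N)t}))_{t\in[0,T]}$ and $(\pi^N(X^N_{\kappa(N)t}))_{t\in[0,T]}$ on the Skorokhod space $\mathbb D_{[0,T]}(\mathcal M_F([0,1]))$ ($\mathcal M_F([0,1])$ being the finite measures on $[0,1]$ with the Lévy–Prokhorov metric, and $d_{J_1}$ the complete Skorokhod $J_1$ metric) are exponentially equivalent: there are probability spaces $(\mathcal X^N,\mathcal F^N,\mathcal Q^N)$ and, on them, random variables $\pi_1^N,\pi_2^N$ with these respective laws such that, for every $\epsilon>0$, the sets $\{d_{J_1}(\pi_1^N,\pi_2^N)>\epsilon\}$ are $\mathcal F^N$-measurable and $$\limsup_{N\to\infty}\frac1N\ln\mathcal Q^N\big\{d_{J_1}(\pi_1^N,\pi_2^N)>\epsilon\big\}=-\infty.$$ -/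

import Mathlib

open MeasureTheory ProbabilityTheory Filter Set Topology
open scoped NNReal ENNReal

noncomputable section

namespace Misanthrope

/-! ### Configurations -/

/-- The set `S_k = {0, …, k}` of admissible occupation numbers; all of `ℕ` for `k = ∞`. -/
abbrev Occ (k : ℕ∞) : Type := {n : ℕ // (n : ℕ∞) ≤ k}

/-- The bulk `Λ_N = {1, …, N - 1}` as a set of integers (empty for `N ≤ 1`). -/
def bulk (N : ℕ) : Finset ℤ := Finset.Icc 1 ((N : ℤ) - 1)

/-- The space of configurations, `S_k ^ Λ_N`, with its discrete topology and σ-algebra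
(which are the product ones). -/
abbrev Config (k : ℕ∞) (N : ℕ) : Type := ↥(bulk N) → Occ k

variable {k : ℕ∞} {N : ℕ}

/-- One particle less at `x`; nothing happens if `x` is empty. -/
def down (η : Config k N) (x : ↥(bulk N)) : Config k N :=
  Function.update η x
    ⟨(η x : ℕ) - 1, le_trans (Nat.cast_le.mpr (Nat.sub_le _ _)) (η x).2⟩

open Classical in
/-- One particle more at `x`; nothing happens if `x` already holds `k` particles. -/
def up (η : Config k N) (x : ↥(bulk N)) : Config k N :=
  if h : ((η x : ℕ) : ℕ∞) < k then
    Function.update η x ⟨(η x : ℕ) + 1, by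
      rw [Nat.cast_add, Nat.cast_one]; exact Order.add_one_le_of_lt h⟩
  else η

open Classical in
/-- A particle jumps from `x` to `y`; nothing happens if `x` is empty or `y` is full. -/
def jump (η : Config k N) (x y : ↥(bulk N)) : Config k N :=
  if (η x : ℕ) = 0 ∨ ((η y : ℕ) : ℕ∞) = k then η else up (down η x) y

/-! ### Generators -/

/-- The generator of the bulk dynamics. -/
def bulkGen (p : ℤ → ℤ → ℝ≥0) (bBulk : Occ k → Occ k → ℝ≥0)
    (f : Config k N → ℝ) (η : Config k N) : ℝ :=
  ∑ x : ↥(bulk N), ∑ y : ↥(bulk N),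
    (p x y : ℝ) * (bBulk (η x) (η y) : ℝ) * (f (jump η x y) - f η)

/-- The generator of the influx of particles from outside of the bulk. -/
def influxGen (p : ℤ → ℤ → ℝ≥0) (bIn : ℤ → Occ k → ℝ≥0)
    (f : Config k N → ℝ) (η : Config k N) : ℝ :=
  ∑' x : {x : ℤ // x ∉ bulk N}, ∑ y : ↥(bulk N),
    (p x y : ℝ) * (bIn x (η y) : ℝ) * (f (up η y) - f η)

/-- The generator of the outflux of particles out of the bulk. -/
def outfluxGen (p : ℤ → ℤ → ℝ≥0) (bOut : Occ k → ℤ → ℝ≥0)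
    (f : Config k N → ℝ) (η : Config k N) : ℝ :=
  ∑ x : ↥(bulk N), ∑' y : {y : ℤ // y ∉ bulk N},
    (p x y : ℝ) * (bOut (η x) y : ℝ) * (f (down η x) - f η)

/-- The generator of the process in contact with reservoirs of strength `θ`. -/
def reservoirGen (p : ℤ → ℤ → ℝ≥0) (bBulk : Occ k → Occ k → ℝ≥0) (bIn : ℤ → Occ k → ℝ≥0)
    (bOut : Occ k → ℤ → ℝ≥0) (θ : ℝ≥0) (f : Config k N → ℝ) (η : Config k N) : ℝ :=
  bulkGen p bBulk f η + (θ : ℝ) * (influxGen p bIn f η + outfluxGen p bOut f η)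

/-- The total jump kernel across the boundary,
`∑_{x ∈ Λ_N, y ∉ Λ_N} (p(x,y) + p(y,x))`, as a sum in `[0, ∞]`. -/
def boundarySum (p : ℤ → ℤ → ℝ≥0) (N : ℕ) : ℝ≥0∞ :=
  ∑ x : ↥(bulk N), ∑' y : {y : ℤ // y ∉ bulk N}, ((p x y : ℝ≥0∞) + (p y x : ℝ≥0∞))

/-! ### Càdlàg paths and Markov processes -/

/-- Right-continuous with left limits. (At a left endpoint of the index set the condition on
left limits is void, since there `𝓝[<] t = ⊥`.) -/
def IsCadlag {ι E : Type*} [TopologicalSpace ι] [Preorder ι] [TopologicalSpace E]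
    (f : ι → E) : Prop :=
  ∀ t, ContinuousWithinAt f (Ici t) t ∧ ∃ l, Tendsto f (𝓝[<] t) (𝓝 l)

/-- `X` is a càdlàg process, on the probability space `(Ω, P)`, with values in the countable
discrete space `Config k N` that has the generator `L`, in the sense of the martingale problem:
for every finitely supported function `f`,
`f (X_t) - f (X_0) - ∫_0^t L f (X_s) ds` is a martingale with respect to the natural filtration
of `X`. Since the paths are càdlàg with respect to the discrete topology there is no explosion,
and this determines the law of the Markov jump process with generator `L` and a given initial
distribution. -/
structure IsProcessWithGenerator {Ω : Type*} [MeasurableSpace Ω] (P : Measure Ω)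
    (L : (Config k N → ℝ) → Config k N → ℝ) (X : ℝ≥0 → Ω → Config k N) : Prop where
  measurable : ∀ t, Measurable (X t)
  cadlag : ∀ ω, IsCadlag fun t => X t ω
  martingale : ∀ f : Config k N → ℝ, (Function.support f).Finite →
    Martingale
      (fun (t : ℝ≥0) ω => f (X t ω) - f (X 0 ω) - ∫ s in (0 : ℝ)..t, L f (X s.toNNReal ω))
      (Filtration.natural X fun t => (measurable t).stronglyMeasurable) P

/-! ### Measure-valued paths and the Skorokhod distance -/

/-- The point `x / N` of the unit interval. -/
def scaledSite (x : ↥(bulk N)) : Icc (0 : ℝ) 1 :=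
  ⟨((x : ℤ) : ℝ) / N, by
    have hx := Finset.mem_Icc.mp x.2
    have h1 : (1 : ℝ) ≤ ((x : ℤ) : ℝ) := by exact_mod_cast hx.1
    have h2 : ((x : ℤ) : ℝ) ≤ (N : ℝ) - 1 := by exact_mod_cast hx.2
    exact ⟨by positivity, div_le_one_of_le₀ (by linarith) (by positivity)⟩⟩

/-- The Dirac measure `δ_u`, as an element of `M_F([0,1])`. -/
def diracFinite (u : Icc (0 : ℝ) 1) : FiniteMeasure (Icc (0 : ℝ) 1) :=
  ⟨Measure.dirac u, inferInstance⟩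

/-- The empirical measure `(N - 1)⁻¹ ∑_{x ∈ Λ_N} η(x) δ_{x/N}` in `M_F([0,1])`. -/
def empirical (η : Config k N) : FiniteMeasure (Icc (0 : ℝ) 1) :=
  ((N - 1 : ℕ) : ℝ≥0)⁻¹ • ∑ x : ↥(bulk N),
    ((η x : ℕ) : ℝ≥0) • diracFinite (scaledSite x)

/-- The space `D_{[0,T]}(M_F([0,1]))` of càdlàg paths, for the weak topology on `M_F([0,1])`. -/
def PathSpace (T : ℝ) : Type :=
  {π : Icc (0 : ℝ) T → FiniteMeasure (Icc (0 : ℝ) 1) // IsCadlag π}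

/-- The size of a time change `r`: `sup_{s < t} |log ((r(t) - r(s)) / (t - s))|`. -/
def timeChangeSize {T : ℝ} (r : Icc (0 : ℝ) T ≃o Icc (0 : ℝ) T) : ℝ≥0∞ :=
  ⨆ (s : Icc (0 : ℝ) T) (t : Icc (0 : ℝ) T) (_ : s < t),
    ENNReal.ofReal |Real.log (((r t : ℝ) - (r s : ℝ)) / ((t : ℝ) - (s : ℝ)))|

/-- The (complete) Skorokhod `J₁` distance on `D_{[0,T]}(M_F([0,1]))`, where `M_F([0,1])` carries
the Lévy–Prokhorov metric: the infimum over all increasing bijections `r` of `[0,T]` of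
`max (timeChangeSize r) (sup_t d_LP(π₁(t), π₂(r(t))))`. -/
def skorokhodDist {T : ℝ} (π₁ π₂ : PathSpace T) : ℝ≥0∞ :=
  ⨅ r : Icc (0 : ℝ) T ≃o Icc (0 : ℝ) T,
    max (timeChangeSize r)
      (⨆ t, levyProkhorovEDist (π₁.1 t : Measure (Icc (0 : ℝ) 1)) (π₂.1 (r t)))

/-- The Borel σ-algebra of the Skorokhod topology, generated by the sets that are open for
`skorokhodDist`. -/
instance (T : ℝ) : MeasurableSpace (PathSpace T) :=
  MeasurableSpace.generateFrom
    {U | ∀ π ∈ U, ∃ ε : ℝ≥0∞, 0 < ε ∧ ∀ π', skorokhodDist π π' < ε → π' ∈ U}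

theorem IsCadlag.comp_monotone {ι κ E F : Type*} [TopologicalSpace ι] [LinearOrder ι]
    [OrderTopology ι] [TopologicalSpace κ] [LinearOrder κ]
    [TopologicalSpace E] [TopologicalSpace F]
    {f : κ → E} (hf : IsCadlag f) {h : E → F} (hh : Continuous h)
    {g : ι → κ} (hg : Continuous g) (hm : Monotone g) :
    IsCadlag fun t => h (f (g t)) := by
  intro t
  constructor
  · have h1 : ContinuousWithinAt (f ∘ g) (Ici t) t :=
      (hf (g t)).1.comp hg.continuousWithinAt fun s hs => hm hs
    exact hh.continuousAt.comp_continuousWithinAt h1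
  · by_cases hs : ∃ s < t, g s = g t
    · obtain ⟨s, hst, hgs⟩ := hs
      refine ⟨h (f (g t)), tendsto_const_nhds.congr' ?_⟩
      filter_upwards [Ioo_mem_nhdsLT hst] with u hu
      rw [le_antisymm (hm hu.2.le) (hgs ▸ hm hu.1.le)]
    · obtain ⟨l, hl⟩ := (hf (g t)).2
      refine ⟨h l, (hh.tendsto l).comp (hl.comp ?_)⟩
      refine tendsto_nhdsWithin_iff.mpr ⟨hg.continuousAt.mono_left nhdsWithin_le_nhds, ?_⟩
      filter_upwards [self_mem_nhdsWithin] with u hu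
      exact lt_of_le_of_ne (hm (le_of_lt hu)) fun he => hs ⟨u, hu, he⟩

/-- The measure-valued path `t ↦ empirical (x (κ t))`, `0 ≤ t ≤ T`, of a configuration-valued
path `x` that is sped up by the factor `κ`. -/
def empiricalPath (κ : ℝ≥0) (T : ℝ) (x : ℝ≥0 → Config k N) (hx : IsCadlag x) : PathSpace T :=
  ⟨fun t => empirical (x (κ * (t : ℝ).toNNReal)),
    hx.comp_monotone (h := empirical) continuous_of_discreteTopology
      (g := fun t : Icc (0 : ℝ) T => κ * (t : ℝ).toNNReal)
      (by fun_prop)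
      (fun _ _ hst => mul_le_mul_right (Real.toNNReal_le_toNNReal hst) κ)⟩

/-- The law on `D_{[0,T]}(M_F([0,1]))` of the empirical measure of the process `X` sped up by the
factor `κ`. -/
def empiricalLaw {Ω : Type*} [MeasurableSpace Ω] (P : Measure Ω) (κ : ℝ≥0) (T : ℝ)
    (X : ℝ≥0 → Ω → Config k N) (hX : ∀ ω, IsCadlag fun t => X t ω) : Measure (PathSpace T) :=
  P.map fun ω => empiricalPath κ T (fun t => X t ω) (hX ω)

/-- Exponential equivalence of two sequences of probability measures on
`D_{[0,T]}(M_F([0,1]))`. -/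
def ExponentiallyEquivalent {T : ℝ} (Q₁ Q₂ : ℕ → Measure (PathSpace T)) : Prop :=
  ∃ (E : ℕ → Type) (_ : ∀ N, MeasurableSpace (E N)) (R : ∀ N, Measure (E N))
    (π₁ π₂ : ∀ N, E N → PathSpace T),
    (∀ N, IsProbabilityMeasure (R N)) ∧
    (∀ N, Measurable (π₁ N)) ∧ (∀ N, Measurable (π₂ N)) ∧
    (∀ N, (R N).map (π₁ N) = Q₁ N) ∧ (∀ N, (R N).map (π₂ N) = Q₂ N) ∧
    ∀ ε : ℝ, 0 < ε →
      (∀ N, MeasurableSet {e | ENNReal.ofReal ε < skorokhodDist (π₁ N e) (π₂ N e)}) ∧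
      limsup (fun N : ℕ => (((N : ℝ)⁻¹ : ℝ) : EReal) *
        ENNReal.log (R N {e | ENNReal.ofReal ε < skorokhodDist (π₁ N e) (π₂ N e)})) atTop = ⊥

end Misanthrope

end

open Misanthrope

noncomputable section

namespace Misanthrope

variable {k : ℕ∞} {N : ℕ}

/-! ### The Skorokhod distance as a pseudometric -/

/-! The mechanism is the basic coupling. Both processes make the same bulk jumps at the minimum of
their two rates, each makes the excess jumps alone, and the reservoirs act on `Y` only. Since
`bBulk` increases in the occupation of the origin and decreases in that of the target, a jump made
by one process alone never increases the `ℓ¹` distance of the configurations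
(`discrepancy_jump_le`), and a common jump preserves it (`discrepancy_jump_jump`). Hence the
distance is at most the number of reservoir moves so far. These have total rate at most `θ C *
boundarySum`, so up to time `κ T` their number `J` satisfies `E (1 + v)^J ≤ exp (T C b v)` for every
`b ≥ κ θ * boundarySum`. As `κ θ * boundarySum = o(N)`, Markov's inequality with `v` arbitrarily
large makes `P (J ≥ δ N)` smaller than every `exp (-K N)`. A discrepancy `D` moves the empirical
measure by at most `D / (N - 1)` in the Lévy–Prokhorov distance (`levyProkhorovEDist_empirical_le`).

The two processes are given only through martingale problems on unrelated probability spaces, and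
for `k = ∞` the bulk rates may be unbounded. So no coupled process in continuous time is built; the
laws of the paths are coupled through their values on a fine time grid. The martingale property
bounds the transition probabilities over a time `h` from below by those of a discrete chain, up to
the factor `exp (-q h) (1 + q h)` (`IsProcessWithGenerator.measure_inter_ge`), on a set of
configurations whose total rate is at most `q`. A discrete chain for the basic coupling, frozen
outside of a good set, therefore yields a sub-coupling of the two grid laws (`pow_mul_chainLaw_le`).
Its missing mass comes from leaving the good set and from the factors just mentioned, whose product
tends to `1` as the grid is refined. The sub-coupling is completed to a coupling and lifted from
grid values to whole paths (`exists_coupling_of_discrete`).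

Refining the grid also removes the discretization error: a càdlàg path in a discrete space has
finitely many jumps on a compact interval, and a time change close to the identity moves them onto
the grid (`skorokhodDist_stepPath_le`). The same approximation by countably valued variables gives
measurability of the empirical paths and of their Skorokhod distance. -/

theorem timeChangeSize_refl (T : ℝ) : timeChangeSize (OrderIso.refl (Icc (0 : ℝ) T)) = 0 := by
  simp only [timeChangeSize, OrderIso.refl_apply, ENNReal.iSup_eq_zero]
  intro s t hst
  have : (0 : ℝ) < (t : ℝ) - s := sub_pos.mpr hst
  rw [div_self this.ne']
  simp

theorem timeChangeSize_symm {T : ℝ} (r : Icc (0 : ℝ) T ≃o Icc (0 : ℝ) T) :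
    timeChangeSize r.symm = timeChangeSize r := by
  have key : ∀ r : Icc (0 : ℝ) T ≃o Icc (0 : ℝ) T,
      timeChangeSize r.symm ≤ timeChangeSize r := by
    intro r
    refine iSup_le fun s => iSup_le fun t => iSup_le fun hst => ?_
    refine le_trans (le_of_eq ?_) (le_iSup_of_le (r.symm s) (le_iSup_of_le (r.symm t)
      (le_iSup_of_le (r.symm.lt_iff_lt.mpr hst) le_rfl)))
    rw [r.apply_symm_apply, r.apply_symm_apply, ← inv_div, Real.log_inv, abs_neg]
  exact le_antisymm (key r) (key r.symm)

theorem timeChangeSize_trans_le {T : ℝ} (r r' : Icc (0 : ℝ) T ≃o Icc (0 : ℝ) T) :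
    timeChangeSize (r.trans r') ≤ timeChangeSize r + timeChangeSize r' := by
  refine iSup_le fun s => iSup_le fun t => iSup_le fun hst => ?_
  have h1 : (0 : ℝ) < (t : ℝ) - s := sub_pos.mpr hst
  have h2 : (0 : ℝ) < (r t : ℝ) - r s := sub_pos.mpr (r.lt_iff_lt.mpr hst)
  have h3 : (0 : ℝ) < (r' (r t) : ℝ) - r' (r s) :=
    sub_pos.mpr (r'.lt_iff_lt.mpr (r.lt_iff_lt.mpr hst))
  have e : ((r.trans r' t : ℝ) - r.trans r' s) / ((t : ℝ) - s) =
      (((r t : ℝ) - r s) / (t - s)) * (((r' (r t) : ℝ) - r' (r s)) / (r t - r s)) := by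
    simp only [OrderIso.trans_apply]
    field_simp
  rw [e, Real.log_mul (by positivity) (by positivity)]
  refine (ENNReal.ofReal_le_ofReal (abs_add_le _ _)).trans ?_
  refine ENNReal.ofReal_add_le.trans (add_le_add ?_ ?_)
  · exact le_iSup_of_le s (le_iSup_of_le t (le_iSup_of_le hst le_rfl))
  · exact le_iSup_of_le (r s) (le_iSup_of_le (r t)
      (le_iSup_of_le (r.lt_iff_lt.mpr hst) le_rfl))

theorem skorokhodDist_self {T : ℝ} (π : PathSpace T) : skorokhodDist π π = 0 := by
  refine le_antisymm (iInf_le_of_le (OrderIso.refl _) ?_) bot_le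
  rw [timeChangeSize_refl]
  simp

theorem skorokhodDist_comm {T : ℝ} (π π' : PathSpace T) :
    skorokhodDist π π' = skorokhodDist π' π := by
  have key : ∀ π π' : PathSpace T, skorokhodDist π π' ≤ skorokhodDist π' π := by
    intro π π'
    refine le_iInf fun r => iInf_le_of_le r.symm (max_le_max (timeChangeSize_symm r).le ?_)
    refine iSup_le fun t => le_iSup_of_le (r.symm t) ?_
    rw [r.apply_symm_apply, levyProkhorovEDist_comm]
  exact le_antisymm (key _ _) (key _ _)

theorem skorokhodDist_triangle {T : ℝ} (π₁ π₂ π₃ : PathSpace T) :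
    skorokhodDist π₁ π₃ ≤ skorokhodDist π₁ π₂ + skorokhodDist π₂ π₃ := by
  rw [skorokhodDist.eq_1 π₁ π₂, ENNReal.iInf_add]
  refine le_iInf fun r => ?_
  rw [skorokhodDist.eq_1 π₂ π₃, ENNReal.add_iInf]
  refine le_iInf fun r' => iInf_le_of_le (r.trans r') (max_le ?_ ?_)
  · exact (timeChangeSize_trans_le r r').trans (add_le_add (le_max_left _ _) (le_max_left _ _))
  · refine iSup_le fun t => (levyProkhorovEDist_triangle _ (π₂.1 (r t) : Measure _) _).trans
      (add_le_add ?_ ?_)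
    · refine le_trans ?_ (le_max_right _ _)
      exact le_iSup_of_le t le_rfl
    · refine le_trans ?_ (le_max_right _ _)
      exact le_iSup_of_le (r t) le_rfl

/-- Makes limits and Borel measurability with respect to the Skorokhod distance available.
Separation of points is never needed. -/
instance instPseudoEMetricSpacePathSpace (T : ℝ) : PseudoEMetricSpace (PathSpace T) where
  edist := skorokhodDist
  edist_self := skorokhodDist_self
  edist_comm := skorokhodDist_comm
  edist_triangle := skorokhodDist_triangle

instance instBorelSpacePathSpace (T : ℝ) : BorelSpace (PathSpace T) where
  measurable_eq := by
    unfold borel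
    change MeasurableSpace.generateFrom _ = _
    congr 1
    ext U
    simp only [mem_ofPred_eq, EMetric.isOpen_iff]
    refine forall₂_congr fun π _ => exists_congr fun ε => and_congr_right fun _ => ?_
    refine forall_congr' fun π' => ?_
    rw [Metric.mem_eball, edist_comm]
    rfl

theorem skorokhodDist_le_iSup {T : ℝ} (π π' : PathSpace T) :
    skorokhodDist π π' ≤
      ⨆ t, levyProkhorovEDist (π.1 t : Measure (Icc (0 : ℝ) 1)) (π'.1 t) := by
  refine iInf_le_of_le (OrderIso.refl _) ?_
  rw [timeChangeSize_refl]
  simp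

/-! ### The number of discrepancies -/

/-- The total number of particles. -/
def count (η : Config k N) : ℕ := ∑ x, (η x : ℕ)

/-- The `ℓ¹` distance of two configurations. -/
def discrepancy (ξ η : Config k N) : ℕ := ∑ x, Nat.dist (ξ x) (η x)

theorem discrepancy_self (η : Config k N) : discrepancy η η = 0 := by
  simp [discrepancy, Nat.dist_self]

theorem count_le_count_add_discrepancy (ξ η : Config k N) :
    count ξ ≤ count η + discrepancy ξ η := by
  rw [count, count, discrepancy, ← Finset.sum_add_distrib]
  refine Finset.sum_le_sum fun x _ => ?_
  unfold Nat.dist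
  omega

/-- The substitute for compactness when `k = ∞`: every quantity is bounded as long as the number of
particles is. -/
theorem finite_setOf_count_le (M : ℕ) : {η : Config k N | count η ≤ M}.Finite := by
  have h : {η : Config k N | ∀ x, (η x : ℕ) ∈ Iic M}.Finite := by
    exact Set.Finite.pi' (t := fun _ : ↥(bulk N) => (Subtype.val ⁻¹' Iic M : Set (Occ k)))
      fun _ => (finite_Iic M).preimage Subtype.val_injective.injOn
  refine h.subset fun η hη x => ?_
  exact (Finset.single_le_sum (f := fun x => (η x : ℕ)) (fun _ _ => Nat.zero_le _)
    (Finset.mem_univ x)).trans hη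

theorem empirical_apply (η : Config k N) (B : Set (Icc (0 : ℝ) 1)) (hB : MeasurableSet B) :
    (empirical η : Measure (Icc (0 : ℝ) 1)) B =
      (((N - 1 : ℕ) : ℝ≥0)⁻¹ : ℝ≥0) *
        ∑ x : ↥(bulk N), ((η x : ℕ) : ℝ≥0∞) * B.indicator 1 (scaledSite x) := by
  simp only [empirical, FiniteMeasure.toMeasure_smul, FiniteMeasure.toMeasure_sum]
  rw [Measure.smul_apply, Measure.finsetSum_apply]
  rw [ENNReal.smul_def, smul_eq_mul]
  congr 1
  refine Finset.sum_congr rfl fun x _ => ?_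
  rw [Measure.smul_apply]
  change _ • Measure.dirac (scaledSite x) B = _
  rw [Measure.dirac_apply' _ hB, ENNReal.smul_def, smul_eq_mul]
  simp

/-- The masses of every single Borel set differ by at most this bound, so no enlargement of the set
is needed beyond the trivial inclusion in its thickening. -/
theorem levyProkhorovEDist_empirical_le (ξ η : Config k N) :
    levyProkhorovEDist (empirical ξ : Measure (Icc (0 : ℝ) 1)) (empirical η) ≤
      (((N - 1 : ℕ) : ℝ≥0)⁻¹ : ℝ≥0) * (discrepancy ξ η : ℝ≥0∞) := by
  have key : ∀ (ξ η : Config k N) (B : Set (Icc (0 : ℝ) 1)), MeasurableSet B →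
      (empirical ξ : Measure (Icc (0 : ℝ) 1)) B ≤ (empirical η : Measure (Icc (0 : ℝ) 1)) B +
        (((N - 1 : ℕ) : ℝ≥0)⁻¹ : ℝ≥0) * (discrepancy ξ η : ℝ≥0∞) := by
    intro ξ η B hB
    rw [empirical_apply _ _ hB, empirical_apply _ _ hB, ← mul_add]
    refine mul_le_mul_right ?_ _
    rw [discrepancy, Nat.cast_sum, ← Finset.sum_add_distrib]
    refine Finset.sum_le_sum fun x _ => ?_
    by_cases hx : scaledSite x ∈ B
    · simp only [indicator_of_mem hx, Pi.one_apply, mul_one]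
      have : (ξ x : ℕ) ≤ η x + Nat.dist (ξ x) (η x) := by unfold Nat.dist; omega
      exact_mod_cast this
    · simp [indicator_of_notMem hx]
  have hD : discrepancy η ξ = discrepancy ξ η := by
    simp only [discrepancy, Nat.dist_comm]
  refine levyProkhorovEDist_le_of_forall _ _ _ fun ε B hε hε' hB => ⟨?_, ?_⟩
  · refine (key ξ η B hB).trans (add_le_add (measure_mono (Metric.self_subset_thickening ?_ B))
      hε.le)
    exact ENNReal.toReal_pos (pos_of_gt hε).ne' hε'.ne
  · rw [← hD] at hε
    refine (key η ξ B hB).trans (add_le_add (measure_mono (Metric.self_subset_thickening ?_ B))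
      hε.le)
    exact ENNReal.toReal_pos (pos_of_gt hε).ne' hε'.ne

/-! ### Discretization of càdlàg paths -/

theorem isCadlag_floor : IsCadlag (Int.floor : ℝ → ℤ) := fun t =>
  ⟨(tendsto_floor_right_pure_floor t).mono_right (pure_le_nhds _),
    _, (tendsto_floor_left_pure_ceil_sub_one t).mono_right (pure_le_nhds _)⟩

/-- A càdlàg path in a discrete space has finitely many jumps on a compact interval. -/
theorem IsCadlag.exists_finset_jumps {C : Type*} [TopologicalSpace C] [DiscreteTopology C]
    {f : ℝ → C} (hf : IsCadlag f) (a b : ℝ) :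
    ∃ F : Finset ℝ, ↑F ⊆ Icc a b ∧ ∀ s ∈ Icc a b, ∀ t ∈ Icc a b,
      (∀ u ∈ F, u ≤ s ↔ u ≤ t) → f s = f t := by
  have hloc : ∀ t, ∃ U ∈ 𝓝 t, IsOpen U ∧ ((∀ u ∈ U, t ≤ u → f u = f t) ∧
      ∃ l, ∀ u ∈ U, u < t → f u = l) := by
    intro t
    obtain ⟨h1, l, h2⟩ := hf t
    have h1' : ∀ᶠ u in 𝓝 t, t ≤ u → f u = f t := by
      have := h1.eventually (eventually_of_mem (isOpen_discrete {f t} |>.mem_nhds rfl)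
        fun _ h => h)
      exact eventually_nhdsWithin_iff.mp this
    have h2' : ∀ᶠ u in 𝓝 t, u < t → f u = l := by
      have := h2.eventually (eventually_of_mem (isOpen_discrete {l} |>.mem_nhds rfl)
        fun _ h => h)
      exact eventually_nhdsWithin_iff.mp this
    obtain ⟨U, hU, hUo, htU⟩ := eventually_nhds_iff.mp (h1'.and h2')
    exact ⟨U, hUo.mem_nhds htU, hUo, fun u hu => (hU u hu).1, l, fun u hu => (hU u hu).2⟩
  choose U hU hUo hR l hL using hloc
  obtain ⟨F, hF, hcov⟩ := isCompact_Icc.elim_nhds_subcover (s := Icc a b) U fun t _ => hU t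
  refine ⟨F, hF, ?_⟩
  have key : ∀ s ∈ Icc a b, ∀ t ∈ Icc a b, s ≤ t →
      (∀ u ∈ F, u ≤ s ↔ u ≤ t) → f s = f t := by
    intro s hs t ht hst h
    -- No centre `u` lies in `(s, t]`. Each neighbourhood therefore meets `[s, t]` only on the right
    -- of its centre (centre included) or strictly on the left, and `f` is constant on either side.
    have hc : ContinuousOn f (Icc s t) := by
      intro v hv
      obtain ⟨u, huF, hvu⟩ := mem_iUnion₂.mp (hcov ⟨hs.1.trans hv.1, hv.2.trans ht.2⟩)
      have hev : ∀ᶠ w in 𝓝[Icc s t] v, w ∈ U u ∩ Icc s t :=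
        inter_mem (mem_nhdsWithin_of_mem_nhds ((hUo u).mem_nhds hvu)) self_mem_nhdsWithin
      refine (tendsto_const_nhds (x := f v)).congr' ?_
      filter_upwards [hev] with w hw
      by_cases hu : u ≤ s
      · rw [hR u v hvu (hu.trans hv.1), hR u w hw.1 (hu.trans hw.2.1)]
      · have hu' : t < u := not_le.mp fun h' => hu ((h u huF).mpr h')
        rw [hL u v hvu (hv.2.trans_lt hu'), hL u w hw.1 (hw.2.2.trans_lt hu')]
    exact isPreconnected_Icc.constant hc (left_mem_Icc.mpr hst) (right_mem_Icc.mpr hst)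
  intro s hs t ht h
  rcases le_total s t with hst | hst
  · exact key s hs t ht hst h
  · exact (key t ht s hs hst fun u hu => (h u hu).symm).symm

/-- Adding a Lipschitz function with a small constant to the identity yields a time change. -/
theorem exists_timeChange {T : ℝ} (hT : 0 < T) {h : ℝ → ℝ} {L : ℝ≥0} (hL : (L : ℝ) ≤ 1 / 2)
    (hh : LipschitzWith L h) (h0 : h 0 = 0) (h1 : h T = 0) :
    ∃ r : Icc (0 : ℝ) T ≃o Icc (0 : ℝ) T, (∀ t, (r t : ℝ) = t + h t) ∧
      timeChangeSize r ≤ ENNReal.ofReal (2 * L) := by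
  have hdiff : ∀ s t, s < t → |h t - h s| ≤ L * (t - s) := by
    intro s t hst
    have := hh.dist_le_mul t s
    rwa [Real.dist_eq, Real.dist_eq, abs_of_pos (sub_pos.mpr hst)] at this
  have hmono : StrictMono fun t : ℝ => t + h t := by
    intro s t hst
    have h2 := (abs_le.mp (hdiff s t hst)).1
    have h3 : 0 < t - s := sub_pos.mpr hst
    change s + h s < t + h t
    nlinarith
  have hmem : ∀ t : Icc (0 : ℝ) T, (t : ℝ) + h t ∈ Icc (0 : ℝ) T := by
    intro t
    have e0 := hmono.monotone t.2.1
    have e1 := hmono.monotone t.2.2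
    simp only [h0, h1, add_zero] at e0 e1
    exact ⟨e0, e1⟩
  let g : Icc (0 : ℝ) T → Icc (0 : ℝ) T := fun t => ⟨t + h t, hmem t⟩
  have hg : StrictMono g := fun s t hst => hmono hst
  have hsurj : Function.Surjective g := by
    intro y
    have hc : ContinuousOn (fun t : ℝ => t + h t) (Icc 0 T) :=
      (continuous_id.add hh.continuous).continuousOn
    have := intermediate_value_Icc hT.le hc
    simp only [h0, h1, add_zero] at this
    obtain ⟨t, ht, hty⟩ := this y.2
    exact ⟨⟨t, ht⟩, Subtype.ext hty⟩
  refine ⟨hg.orderIsoOfSurjective g hsurj, fun t => rfl, ?_⟩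
  refine iSup_le fun s => iSup_le fun t => iSup_le fun hst => ENNReal.ofReal_le_ofReal ?_
  have hst' : (0 : ℝ) < (t : ℝ) - s := sub_pos.mpr hst
  change |Real.log (((t + h t : ℝ) - (s + h s)) / (t - s))| ≤ _
  have h2 := abs_le.mp (hdiff s t hst)
  set q := ((t + h t : ℝ) - (s + h s)) / (t - s) with hq
  have hq1 : q ≤ 1 + L := by
    rw [hq, div_le_iff₀ hst']; linarith [h2.2]
  have hq2 : 1 - L ≤ q := by
    rw [hq, le_div_iff₀ hst']; linarith [h2.1]
  have hL0 : (0 : ℝ) ≤ L := L.2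
  have hqpos : 0 < q := by linarith
  rw [abs_le]
  constructor
  · have h3 := Real.one_sub_inv_le_log_of_pos hqpos
    -- From `1 / (1 - L) ≤ 1 + 2 L`, which is where `L ≤ 1 / 2` enters.
    have h4 : q⁻¹ ≤ 1 + 2 * L := by
      rw [inv_le_iff_one_le_mul₀ hqpos]
      nlinarith
    linarith
  · have := Real.log_le_sub_one_of_pos hqpos
    linarith

/-- The index of the last of the grid points `i T / n` before time `t`. -/
def gridIndex (T : ℝ) (n : ℕ) (t : ℝ) : Fin (n + 1) :=
  ⟨min ⌊n * t / T⌋.toNat n, by omega⟩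

/-- The measure-valued step path with given values on the grid. -/
def stepPath (T : ℝ) (n : ℕ) (a : Fin (n + 1) → Config k N) : PathSpace T :=
  ⟨fun t => empirical (a (gridIndex T n t)), by
    by_cases hT : 0 ≤ T
    · exact isCadlag_floor.comp_monotone
        (h := fun z => empirical (a ⟨min z.toNat n, by omega⟩)) continuous_of_discreteTopology
        (g := fun t : Icc (0 : ℝ) T => n * (t : ℝ) / T) (by fun_prop)
        (fun s t hst => div_le_div_of_nonneg_right
          (mul_le_mul_of_nonneg_left hst (Nat.cast_nonneg _)) hT)
    · intro t
      exact absurd (t.2.1.trans t.2.2) hT⟩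

/-- The time step of a grid with `n` steps for a process that is sped up by `κ`. -/
def gridStep (κ : ℝ≥0) (T : ℝ) (n : ℕ) : ℝ≥0 := κ * T.toNNReal / n

/-- The values of a path on the first `n + 1` points of a grid. -/
def gridValues (h : ℝ≥0) (n : ℕ) (x : ℝ≥0 → Config k N) : Fin (n + 1) → Config k N :=
  fun i => x ((i : ℕ) * h)

/-- The time change carries every jump time to the next grid point, where the step path jumps. The
two paths then agree exactly, and only the size of the time change contributes: displacements of at
most `T / n` against gaps of at least `d`. -/
theorem skorokhodDist_stepPath_le {T : ℝ} (hT : 0 < T) (κ : ℝ≥0) {x : ℝ≥0 → Config k N}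
    (hx : IsCadlag x) : ∃ d : ℝ, 0 < d ∧ ∀ n : ℕ, 0 < n → T / n / d ≤ 1 / 2 →
      skorokhodDist (empiricalPath κ T x hx) (stepPath T n (gridValues (gridStep κ T n) n x)) ≤
        ENNReal.ofReal (2 * (T / n / d)) := by
  let f : ℝ → Config k N := fun t => x (κ * t.toNNReal)
  have hf : IsCadlag f :=
    hx.comp_monotone (h := id) continuous_id (g := fun t : ℝ => κ * t.toNNReal) (by fun_prop)
      (fun _ _ hst => mul_le_mul_right (Real.toNNReal_le_toNNReal hst) κ)
  obtain ⟨F₀, hF₀, hconst⟩ := hf.exists_finset_jumps 0 T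
  classical
  -- The end points are included so that the time change fixes them.
  let F : Finset ℝ := insert 0 (insert T F₀)
  obtain ⟨d, hd, hgap⟩ : ∃ d : ℝ, 0 < d ∧ ∀ u ∈ F, ∀ v ∈ F, u ≠ v → d ≤ |u - v| := by
    let G : Finset ℝ := insert 1 (F.offDiag.image fun p => |p.1 - p.2|)
    have hG : G.Nonempty := ⟨1, Finset.mem_insert_self _ _⟩
    refine ⟨G.min' hG, ?_, fun u hu v hv huv => G.min'_le _ ?_⟩
    · rw [Finset.lt_min'_iff]
      intro y hy
      rcases Finset.mem_insert.mp hy with rfl | hy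
      · exact one_pos
      · obtain ⟨p, hp, rfl⟩ := Finset.mem_image.mp hy
        exact abs_pos.mpr (sub_ne_zero.mpr (Finset.mem_offDiag.mp hp).2.2)
    · exact Finset.mem_insert_of_mem
        (Finset.mem_image.mpr ⟨(u, v), Finset.mem_offDiag.mpr ⟨hu, hv, huv⟩, rfl⟩)
  refine ⟨d, hd, fun n hn hsmall => ?_⟩
  have hn' : (0 : ℝ) < n := Nat.cast_pos.mpr hn
  have hTn : 0 < T / n := by positivity
  -- The displacement that rounds `v` up to the grid. It is used on `F` only, and is extended from
  -- there to a function with the same Lipschitz constant.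
  let ρ : ℝ → ℝ := fun v => ⌈n * v / T⌉ * (T / n) - v
  have hρ : ∀ v, 0 ≤ ρ v ∧ ρ v ≤ T / n := by
    intro v
    have e1 := Int.le_ceil (n * v / T)
    have e2 := (Int.ceil_lt_add_one (n * v / T)).le
    have e3 : n * v / T * (T / n) = v := by field_simp
    have e4 := mul_le_mul_of_nonneg_right e1 hTn.le
    have e5 := mul_le_mul_of_nonneg_right e2 hTn.le
    rw [e3] at e4
    rw [add_mul, e3, one_mul] at e5
    constructor <;> simp only [ρ] <;> linarith
  have hLip : LipschitzOnWith (T / n / d).toNNReal ρ F := by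
    refine LipschitzOnWith.of_dist_le_mul fun u hu v hv => ?_
    by_cases huv : u = v
    · simp [huv]
    · rw [Real.dist_eq, Real.dist_eq, Real.coe_toNNReal _ (by positivity)]
      have h1 : |ρ u - ρ v| ≤ T / n := by
        rw [abs_le]
        constructor <;> linarith [hρ u, hρ v, (hρ u).1, (hρ u).2, (hρ v).1, (hρ v).2]
      have h2 := hgap u hu v hv huv
      calc |ρ u - ρ v| ≤ T / n := h1
        _ = T / n / d * d := by field_simp
        _ ≤ _ := mul_le_mul_of_nonneg_left h2 (by positivity)
  obtain ⟨h, hh, heq⟩ := hLip.extend_real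
  have h0 : h 0 = 0 := by
    rw [← heq (by simp [F])]; simp [ρ]
  have hT0 : h T = 0 := by
    rw [← heq (by simp [F])]
    have : (n : ℝ) * T / T = (n : ℤ) := by
      rw [mul_div_assoc, div_self hT.ne', mul_one, Int.cast_natCast]
    simp only [ρ, this, Int.ceil_intCast]
    rw [Int.cast_natCast]; field_simp; ring
  obtain ⟨r, hr, hsize⟩ := exists_timeChange hT
    (by rw [Real.coe_toNNReal _ (by positivity)]; exact hsmall) hh h0 hT0
  rw [Real.coe_toNNReal _ (by positivity)] at hsize
  refine iInf_le_of_le r (max_le hsize (iSup_le fun t => ?_))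
  suffices he : f t = gridValues (gridStep κ T n) n x (gridIndex T n (r t)) by
    change levyProkhorovEDist (empirical (f t) : Measure (Icc (0 : ℝ) 1))
      (empirical (gridValues (gridStep κ T n) n x (gridIndex T n (r t)))) ≤ _
    rw [he, levyProkhorovEDist_self]
    exact bot_le
  have hfl0 : 0 ≤ ⌊n * (r t : ℝ) / T⌋ :=
    Int.floor_nonneg.mpr (div_nonneg (mul_nonneg hn'.le (r t).2.1) hT.le)
  have hrt : (n : ℝ) * (r t) / T ≤ n := by
    rw [div_le_iff₀ hT]; exact mul_le_mul_of_nonneg_left (r t).2.2 hn'.le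
  have hfln : ⌊n * (r t : ℝ) / T⌋ ≤ n := by
    have := (Int.floor_le (n * (r t : ℝ) / T)).trans hrt
    exact_mod_cast this
  set i := ⌊n * (r t : ℝ) / T⌋ with hi
  have hidx : ((gridIndex T n (r t) : Fin (n + 1)) : ℕ) = i.toNat := by
    change min i.toNat n = i.toNat
    omega
  have hicast : ((i.toNat : ℕ) : ℝ) = i := by
    exact_mod_cast Int.toNat_of_nonneg hfl0
  have hs : (i : ℝ) * (T / n) ∈ Icc 0 T := by
    refine ⟨mul_nonneg (by exact_mod_cast hfl0) hTn.le, ?_⟩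
    calc (i : ℝ) * (T / n) ≤ n * (T / n) :=
          mul_le_mul_of_nonneg_right (by exact_mod_cast hfln) hTn.le
      _ = T := by field_simp
  have hgv : gridValues (gridStep κ T n) n x (gridIndex T n (r t)) = f (i * (T / n)) := by
    simp only [gridValues, f, hidx]
    congr 1
    rw [← hicast, Real.toNNReal_mul (Nat.cast_nonneg _), Real.toNNReal_div hT.le,
      Real.toNNReal_natCast, Real.toNNReal_natCast, gridStep]
    ring
  rw [hgv]
  refine hconst _ t.2 _ hs fun v hv => ?_
  have hvI := hF₀ hv
  have hvF : v ∈ F := by simp [F, hv]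
  have hrv : (r ⟨v, hvI⟩ : ℝ) = ⌈n * v / T⌉ * (T / n) := by
    rw [hr, ← heq hvF]; simp [ρ]
  -- Rounding up is what right-continuity requires: a jump at `v` is first seen at the first grid
  -- point that is not before `v`.
  calc v ≤ (t : ℝ) ↔ (⟨v, hvI⟩ : Icc (0 : ℝ) T) ≤ t := Iff.rfl
    _ ↔ (r ⟨v, hvI⟩ : ℝ) ≤ r t := (r.le_iff_le (x := ⟨v, hvI⟩) (y := t)).symm
    _ ↔ (⌈n * v / T⌉ : ℝ) ≤ n * (r t) / T := by
        rw [hrv, mul_div_assoc', div_le_iff₀ hn', le_div_iff₀ hT, mul_comm (r t : ℝ)]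
    _ ↔ ⌈n * v / T⌉ ≤ i := Int.le_floor.symm
    _ ↔ n * v / T ≤ i := Int.ceil_le
    _ ↔ v ≤ i * (T / n) := by
        rw [mul_div_assoc', div_le_iff₀ hT, le_div_iff₀ hn', mul_comm v]

theorem tendsto_stepPath {T : ℝ} (hT : 0 < T) (κ : ℝ≥0) {x : ℝ≥0 → Config k N}
    (hx : IsCadlag x) :
    Tendsto (fun n => stepPath T n (gridValues (gridStep κ T n) n x)) atTop
      (𝓝 (empiricalPath κ T x hx)) := by
  obtain ⟨d, hd, h⟩ := skorokhodDist_stepPath_le hT κ hx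
  have hlim : Tendsto (fun n : ℕ => T / n / d) atTop (𝓝 0) := by
    simpa using (tendsto_const_div_atTop_nhds_zero_nat T).div_const d
  rw [tendsto_iff_edist_tendsto_0]
  have hlim' : Tendsto (fun n : ℕ => ENNReal.ofReal (2 * (T / n / d))) atTop (𝓝 0) := by
    have := ENNReal.tendsto_ofReal (hlim.const_mul 2)
    simpa using this
  refine tendsto_of_tendsto_of_tendsto_of_le_of_le' tendsto_const_nhds hlim'
    (Eventually.of_forall fun _ => bot_le) ?_
  filter_upwards [eventually_gt_atTop 0, hlim.eventually_le_const (u := 1 / 2) (by norm_num)]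
    with n hn hs
  rw [edist_comm]
  exact h n hn hs

/-! ### The space of configuration-valued paths -/

/-- Càdlàg paths of configurations, with the σ-algebra generated by the evaluations. -/
abbrev ConfigPath (k : ℕ∞) (N : ℕ) : Type := {x : ℝ≥0 → Config k N // IsCadlag x}

/-- The sped-up empirical path of a configuration-valued path. -/
def toEmpirical (κ : ℝ≥0) (T : ℝ) (x : ConfigPath k N) : PathSpace T :=
  empiricalPath κ T x.1 x.2

theorem measurable_gridValues (h : ℝ≥0) (n : ℕ) :
    Measurable fun x : ConfigPath k N => gridValues h n x.1 :=
  measurable_pi_lambda _ fun _ => (measurable_pi_apply _).comp measurable_subtype_coe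

/-- The step paths are functions of a vector of grid values, which lies in a countable discrete
space, so each of them is measurable for free; the limit inherits this. -/
theorem measurable_toEmpirical {T : ℝ} (hT : 0 < T) (κ : ℝ≥0) :
    Measurable (toEmpirical κ T : ConfigPath k N → PathSpace T) := by
  refine measurable_of_tendsto_metrizable
    (f := fun n x => stepPath T n (gridValues (gridStep κ T n) n x.1)) (fun n => ?_) ?_
  · exact (Measurable.of_discrete (f := stepPath T n)).comp (measurable_gridValues _ n)
  · exact tendsto_pi_nhds.mpr fun x => tendsto_stepPath hT κ x.2

theorem measurable_edist_toEmpirical_stepPath {T : ℝ} (hT : 0 < T) (κ : ℝ≥0) (n : ℕ) :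
    Measurable fun x : ConfigPath k N =>
      edist (toEmpirical κ T x) (stepPath T n (gridValues (gridStep κ T n) n x.1)) := by
  refine ENNReal.measurable_of_tendsto (f := fun m x =>
    edist (stepPath T m (gridValues (gridStep κ T m) m x.1))
      (stepPath T n (gridValues (gridStep κ T n) n x.1))) (fun m => ?_) ?_
  · have hm : Measurable fun a : (Fin (m + 1) → Config k N) × (Fin (n + 1) → Config k N) =>
        edist (stepPath T m a.1) (stepPath T n a.2) := Measurable.of_discrete
    have hg := (measurable_gridValues (k := k) (N := N) (gridStep κ T m) m).prodMk
      (measurable_gridValues (k := k) (N := N) (gridStep κ T n) n)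
    have hc := hm.comp hg
    exact hc
  · exact tendsto_pi_nhds.mpr fun x => (tendsto_stepPath hT κ x.2).edist tendsto_const_nhds

/-- The distance itself is approximated by distances of step paths, so nothing need be known about
the Borel sets of `PathSpace T × PathSpace T`. -/
theorem measurable_edist_toEmpirical {T : ℝ} (hT : 0 < T) (κ : ℝ≥0) :
    Measurable fun e : ConfigPath k N × ConfigPath k N =>
      edist (toEmpirical κ T e.1) (toEmpirical κ T e.2) := by
  refine ENNReal.measurable_of_tendsto (f := fun m e =>
    edist (stepPath T m (gridValues (gridStep κ T m) m e.1.1))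
      (stepPath T m (gridValues (gridStep κ T m) m e.2.1))) (fun m => ?_) ?_
  · have hm : Measurable fun a : (Fin (m + 1) → Config k N) × (Fin (m + 1) → Config k N) =>
        edist (stepPath T m a.1) (stepPath T m a.2) := Measurable.of_discrete
    have hg := ((measurable_gridValues (k := k) (N := N) (gridStep κ T m) m).comp
      (measurable_fst (β := ConfigPath k N))).prodMk
        ((measurable_gridValues (k := k) (N := N) (gridStep κ T m) m).comp
          (measurable_snd (α := ConfigPath k N)))
    have hc := hm.comp hg
    exact hc
  · exact tendsto_pi_nhds.mpr fun e =>
      (tendsto_stepPath hT κ e.1.2).edist (tendsto_stepPath hT κ e.2.2)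

/-- Fine discretizations are close to the path with high probability. -/
theorem eventually_measure_edist_stepPath_lt {T : ℝ} (hT : 0 < T) (κ : ℝ≥0)
    (μ : Measure (ConfigPath k N)) [IsFiniteMeasure μ] {ε δ : ℝ≥0∞} (hε : 0 < ε) (hδ : 0 < δ) :
    ∀ᶠ n in atTop, μ {x | ε ≤ edist (toEmpirical κ T x)
      (stepPath T n (gridValues (gridStep κ T n) n x.1))} < δ := by
  have h := tendsto_measure_of_ae_tendsto_indicator_of_isFiniteMeasure (μ := μ) (L := atTop)
    (A := ∅) MeasurableSet.empty
    (As := fun n => {x | ε ≤ edist (toEmpirical κ T x)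
      (stepPath T n (gridValues (gridStep κ T n) n x.1))})
    (fun n => measurableSet_le measurable_const (measurable_edist_toEmpirical_stepPath hT κ n))
    (Eventually.of_forall fun x => ?_)
  · rw [measure_empty] at h
    exact h.eventually_lt_const hδ
  · have := tendsto_iff_edist_tendsto_0.mp (tendsto_stepPath hT κ x.2)
    filter_upwards [this.eventually_lt_const hε] with n hn
    simp only [mem_empty_iff_false, iff_false, not_le]
    rw [edist_comm]
    exact hn

theorem edist_stepPath_le (T : ℝ) (n : ℕ) (a b : Fin (n + 1) → Config k N) {D : ℕ}
    (h : ∀ i, discrepancy (a i) (b i) ≤ D) :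
    edist (stepPath T n a) (stepPath T n b) ≤ (((N - 1 : ℕ) : ℝ≥0)⁻¹ : ℝ≥0) * (D : ℝ≥0∞) := by
  refine (skorokhodDist_le_iSup _ _).trans (iSup_le fun t => ?_)
  refine (levyProkhorovEDist_empirical_le _ _).trans (mul_le_mul_right ?_ _)
  exact_mod_cast h _

/-! ### Transition probabilities of a process with a given generator -/

/-- The indicator function of a single configuration. -/
def pointIndicator (b : Config k N) : Config k N → ℝ := indicator {b} 1

theorem pointIndicator_self (b : Config k N) : pointIndicator b b = 1 := by
  simp [pointIndicator]

theorem pointIndicator_of_ne {a b : Config k N} (h : a ≠ b) : pointIndicator b a = 0 := by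
  simp [pointIndicator, h]

theorem finite_support_pointIndicator (b : Config k N) :
    (Function.support (pointIndicator b)).Finite :=
  (finite_singleton b).subset (by simp [pointIndicator])

theorem exists_bound_of_finite_support {C : Type*} {g : C → ℝ}
    (hg : (Function.support g).Finite) : ∃ K, ∀ x, ‖g x‖ ≤ K := by
  obtain ⟨K, hK⟩ := (hg.image fun x => ‖g x‖).bddAbove
  refine ⟨max K 0, fun x => ?_⟩
  by_cases hx : x ∈ Function.support g
  · exact (hK ⟨x, hx, rfl⟩).trans (le_max_left _ _)
  · rw [Function.notMem_support.mp hx, norm_zero]; exact le_max_right _ _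

section Transition

variable {Ω : Type*} [MeasurableSpace Ω] {P : Measure Ω} {X : ℝ≥0 → Ω → Config k N}
  {L : (Config k N → ℝ) → Config k N → ℝ}

/-- Time is approximated from the right by the next point of a grid, so that right-continuity gives
the limit. Joint measurability is needed for Fubini in the forward equation. -/
theorem measurable_uncurry_of_isCadlag (hm : ∀ t, Measurable (X t))
    (hc : ∀ ω, IsCadlag fun t => X t ω) : Measurable fun p : ℝ≥0 × Ω => X p.1 p.2 := by
  refine measurable_of_tendsto_metrizable (f := fun (n : ℕ) (p : ℝ≥0 × Ω) =>
    X (((⌊((n : ℝ≥0) + 1) * p.1⌋₊ : ℝ≥0) + 1) / ((n : ℝ≥0) + 1)) p.2) (fun n => ?_) ?_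
  · have h1 : Measurable fun q : ℕ × Ω => X (((q.1 : ℝ≥0) + 1) / ((n : ℝ≥0) + 1)) q.2 :=
      measurable_from_prod_countable_right fun j => hm (((j : ℝ≥0) + 1) / ((n : ℝ≥0) + 1))
    have h2 : Measurable fun p : ℝ≥0 × Ω => (⌊((n : ℝ≥0) + 1) * p.1⌋₊, p.2) :=
      (Nat.measurable_floor.comp (measurable_fst.const_mul _)).prodMk measurable_snd
    have h3 := h1.comp h2
    exact h3
  · refine tendsto_pi_nhds.mpr fun p => ?_
    refine (hc p.2 p.1).1.tendsto.comp (tendsto_nhdsWithin_iff.mpr ⟨?_, ?_⟩)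
    · have hlim : Tendsto (fun n : ℕ => p.1 + 1 / ((n : ℝ≥0) + 1)) atTop (𝓝 p.1) := by
        have := tendsto_const_nhds (x := p.1).add
          (tendsto_one_div_add_atTop_nhds_zero_nat (𝕜 := ℝ≥0))
        simpa using this
      refine tendsto_of_tendsto_of_tendsto_of_le_of_le tendsto_const_nhds hlim ?_ ?_
      · intro n
        have hn : (0 : ℝ≥0) < n + 1 := by positivity
        change p.1 ≤ _ / _
        rw [le_div_iff₀ hn, mul_comm]
        exact (Nat.lt_floor_add_one _).le
      · intro n
        have hn : (0 : ℝ≥0) < n + 1 := by positivity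
        change _ / _ ≤ _ + _ / _
        have e : (p.1 + 1 / ((n : ℝ≥0) + 1)) * (n + 1) = (n + 1) * p.1 + 1 := by field_simp
        rw [div_le_iff₀ hn, e]
        gcongr
        exact Nat.floor_le zero_le
    · refine Eventually.of_forall fun n => ?_
      have hn : (0 : ℝ≥0) < n + 1 := by positivity
      change p.1 ≤ _ / _
      rw [le_div_iff₀ hn, mul_comm]
      exact (Nat.lt_floor_add_one _).le

/-- The natural filtration of the process. -/
abbrev IsProcessWithGenerator.filtration (hX : IsProcessWithGenerator P L X) :=
  Filtration.natural X fun t => (hX.measurable t).stronglyMeasurable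

variable [IsProbabilityMeasure P]

theorem integrable_comp_of_bounded {Y : Ω → Config k N} (hY : Measurable Y) {g : Config k N → ℝ}
    {K : ℝ} (hg : ∀ x, ‖g x‖ ≤ K) : Integrable (fun ω => g (Y ω)) P :=
  Integrable.of_bound ((Measurable.of_discrete (f := g)).comp hY).aestronglyMeasurable K
    (Eventually.of_forall fun _ => hg _)

/-- The forward equation. -/
theorem IsProcessWithGenerator.setIntegral_eq (hX : IsProcessWithGenerator P L X)
    {f : Config k N → ℝ} (hf : (Function.support f).Finite)
    (hLf : (Function.support (L f)).Finite) {s : ℝ≥0} {A : Set Ω}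
    (hA : MeasurableSet[hX.filtration s] A)
    {t : ℝ} (hst : (s : ℝ) ≤ t) :
    ∫ ω in A, f (X t.toNNReal ω) ∂P = ∫ ω in A, f (X s ω) ∂P +
      ∫ u in (s : ℝ)..t, ∫ ω in A, L f (X u.toNNReal ω) ∂P := by
  obtain ⟨Kf, hKf⟩ := exists_bound_of_finite_support hf
  obtain ⟨K, hK⟩ := exists_bound_of_finite_support hLf
  have hle := (hX.martingale f hf).setIntegral_eq (i := s) (j := t.toNNReal)
    (by rw [← NNReal.coe_le_coe, Real.coe_toNNReal _ (s.2.trans hst)]; exact hst) hA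
  have hjoint : Measurable fun p : ℝ × Ω => L f (X p.1.toNNReal p.2) :=
    (Measurable.of_discrete (f := L f)).comp
      ((measurable_uncurry_of_isCadlag hX.measurable hX.cadlag).comp
        ((measurable_real_toNNReal.comp measurable_fst).prodMk measurable_snd))
  have hii : ∀ (ω : Ω) (a b : ℝ),
      IntervalIntegrable (fun u => L f (X u.toNNReal ω)) volume a b := by
    intro ω a b
    refine ⟨?_, ?_⟩ <;>
    · exact IntegrableOn.of_bound (by simp)
        (hjoint.comp (measurable_id.prodMk measurable_const)).aestronglyMeasurable K
        (Eventually.of_forall fun _ => hK _)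
  have hIm : ∀ a b : ℝ, Integrable (fun ω => ∫ u in a..b, L f (X u.toNNReal ω)) (P.restrict A) := by
    intro a b
    refine Integrable.of_bound (C := K * |b - a|) ?_ (Eventually.of_forall fun ω => ?_)
    · simp only [intervalIntegral]
      have hsm : StronglyMeasurable
          (Function.uncurry fun (ω : Ω) (u : ℝ) => L f (X u.toNNReal ω)) :=
        (hjoint.comp measurable_swap).stronglyMeasurable
      exact (hsm.integral_prod_right.sub hsm.integral_prod_right).aestronglyMeasurable
    · exact intervalIntegral.norm_integral_le_of_norm_le_const fun u _ => hK _
  have hfi : ∀ r, Integrable (fun ω => f (X r ω)) (P.restrict A) := fun r =>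
    (integrable_comp_of_bounded (hX.measurable r) hKf).integrableOn
  have hfub : ∫ ω in A, (∫ u in (s : ℝ)..t, L f (X u.toNNReal ω)) ∂P =
      ∫ u in (s : ℝ)..t, ∫ ω in A, L f (X u.toNNReal ω) ∂P := by
    refine (intervalIntegral_integral_swap (f := fun u ω => L f (X u.toNNReal ω)) ?_).symm
    have : IsFiniteMeasure (volume.restrict (uIoc (s : ℝ) t)) := ⟨by simp [uIoc]⟩
    exact Integrable.of_bound hjoint.aestronglyMeasurable K (Eventually.of_forall fun _ => hK _)
  have hsplit : ∀ ω, ∫ u in (0 : ℝ)..t, L f (X u.toNNReal ω) =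
      (∫ u in (0 : ℝ)..s, L f (X u.toNNReal ω)) + ∫ u in (s : ℝ)..t, L f (X u.toNNReal ω) :=
    fun ω => (intervalIntegral.integral_add_adjacent_intervals (hii ω _ _) (hii ω _ _)).symm
  rw [Real.coe_toNNReal _ (s.2.trans hst)] at hle
  simp only [hsplit] at hle
  have h1 : ∀ r, Integrable (fun ω => f (X r ω) - f (X 0 ω)) (P.restrict A) :=
    fun r => (hfi r).sub (hfi 0)
  have h2 : Integrable (fun ω => (∫ u in (0 : ℝ)..s, L f (X u.toNNReal ω)) +
      ∫ u in (s : ℝ)..t, L f (X u.toNNReal ω)) (P.restrict A) := (hIm _ _).add (hIm _ _)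
  rw [integral_sub (h1 _) (hIm _ _), integral_sub (hfi _) (hfi _),
    integral_sub (h1 _) h2, integral_sub (hfi _) (hfi _),
    integral_add (hIm _ _) (hIm _ _), hfub] at hle
  linarith

theorem continuousWithinAt_setIntegral (hm : ∀ t, Measurable (X t))
    (hc : ∀ ω, IsCadlag fun t => X t ω) {g : Config k N → ℝ} {K : ℝ} (hg : ∀ x, ‖g x‖ ≤ K)
    (A : Set Ω) (t : ℝ) :
    ContinuousWithinAt (fun u : ℝ => ∫ ω in A, g (X u.toNNReal ω) ∂P) (Ici t) t := by
  refine tendsto_integral_filter_of_dominated_convergence (fun _ => K)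
    (Eventually.of_forall fun u =>
      ((Measurable.of_discrete (f := g)).comp (hm _)).aestronglyMeasurable)
    (Eventually.of_forall fun u => Eventually.of_forall fun ω => hg _)
    (integrable_const _) (Eventually.of_forall fun ω => ?_)
  have h1 := (hc ω t.toNNReal).1
  have h2 : ContinuousWithinAt (fun u : ℝ => u.toNNReal) (Ici t) t :=
    continuous_real_toNNReal.continuousWithinAt
  have h3 : ContinuousWithinAt ((fun u => X u ω) ∘ fun u : ℝ => u.toNNReal) (Ici t) t :=
    h1.comp h2 fun u hu => Real.toNNReal_le_toNNReal hu
  exact (continuous_of_discreteTopology (f := g)).continuousAt.comp_continuousWithinAt h3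

/-- By the forward equation, `u ↦ P (A ∩ {X_u = b})` has a right derivative that is at least `l P (A
∩ {X_u = a}) - q P (A ∩ {X_u = b})`. The factor `exp (q (u - s))` absorbs the loss term, leaving a
derivative of at least `l m`. Right derivatives suffice, since paths are only right-continuous. -/
theorem IsProcessWithGenerator.exp_mul_setIntegral_ge (hX : IsProcessWithGenerator P L X)
    {a b : Config k N} (hLb : (Function.support (L (pointIndicator b))).Finite)
    {q l : ℝ} (hl : 0 ≤ l)
    (hlow : ∀ x, l * pointIndicator a x - q * pointIndicator b x ≤ L (pointIndicator b) x)
    {s : ℝ≥0} {A : Set Ω}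
    (hA : MeasurableSet[hX.filtration s] A)
    {m : ℝ} (ha : ∀ t : ℝ, (s : ℝ) ≤ t →
      m ≤ Real.exp (q * (t - s)) * ∫ ω in A, pointIndicator a (X t.toNNReal ω) ∂P)
    {t : ℝ} (hst : (s : ℝ) ≤ t) :
    (∫ ω in A, pointIndicator b (X s ω) ∂P) + (t - s) * (l * m) ≤
      Real.exp (q * (t - s)) * ∫ ω in A, pointIndicator b (X t.toNNReal ω) ∂P := by
  obtain ⟨K, hK⟩ := exists_bound_of_finite_support hLb
  have hint : ∀ (c : Config k N) (u : ℝ),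
      Integrable (fun ω => pointIndicator c (X u.toNNReal ω)) (P.restrict A) := fun c u => by
    obtain ⟨K', hK'⟩ := exists_bound_of_finite_support (finite_support_pointIndicator c)
    exact (integrable_comp_of_bounded (hX.measurable _) hK').integrableOn
  set G : ℝ → ℝ := fun u => ∫ ω in A, L (pointIndicator b) (X u.toNNReal ω) ∂P with hG
  set φ : ℝ → ℝ := fun u => ∫ ω in A, pointIndicator b (X u.toNNReal ω) ∂P with hφ
  have hGc : ∀ u, ContinuousWithinAt G (Ici u) u := fun u =>
    continuousWithinAt_setIntegral hX.measurable hX.cadlag hK A u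
  have hjoint : Measurable fun p : ℝ × Ω => L (pointIndicator b) (X p.1.toNNReal p.2) :=
    (Measurable.of_discrete (f := L (pointIndicator b))).comp
      ((measurable_uncurry_of_isCadlag hX.measurable hX.cadlag).comp
        ((measurable_real_toNNReal.comp measurable_fst).prodMk measurable_snd))
  have hGm : StronglyMeasurable G := by
    have hsm : StronglyMeasurable
        (Function.uncurry fun (u : ℝ) (ω : Ω) => L (pointIndicator b) (X u.toNNReal ω)) :=
      hjoint.stronglyMeasurable
    exact hsm.integral_prod_right
  have hGb : ∀ u, ‖G u‖ ≤ K * P.real A := fun u =>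
    norm_setIntegral_le_of_norm_le_const (measure_lt_top _ _) (fun ω _ => hK _)
  have hGi : ∀ u v : ℝ, IntervalIntegrable G volume u v := by
    intro u v
    refine ⟨?_, ?_⟩ <;>
    · exact IntegrableOn.of_bound (by simp) hGm.aestronglyMeasurable _
        (Eventually.of_forall fun _ => hGb _)
  have hφeq : ∀ u ∈ Ici (s : ℝ), φ u = φ s + ∫ v in (s : ℝ)..u, G v := by
    intro u hu
    have := hX.setIntegral_eq (finite_support_pointIndicator b) hLb hA hu
    simp only [hφ, Real.toNNReal_coe]
    exact this
  have hderiv : ∀ u ∈ Ici (s : ℝ), HasDerivWithinAt φ (G u) (Ici u) u := by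
    intro u hu
    have h1 : HasDerivWithinAt (fun v => φ s + ∫ w in (s : ℝ)..v, G w) (G u) (Ici u) u :=
      (intervalIntegral.integral_hasDerivWithinAt_right (hGi _ _)
        (hGm.stronglyMeasurableAtFilter) ((hGc u).mono Ioi_subset_Ici_self)).const_add _
    exact h1.congr (fun v hv => hφeq v (le_trans (mem_Ici.mp hu) hv)) (hφeq u hu)
  have hexp : ∀ u, HasDerivAt (fun v : ℝ => Real.exp (q * (v - s)))
      (Real.exp (q * (u - s)) * q) u := by
    intro u
    have := (((hasDerivAt_id u).sub_const (s : ℝ)).const_mul q).exp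
    simpa using this
  have hψ : ∀ u ∈ Ici (s : ℝ), HasDerivWithinAt (fun v => Real.exp (q * (v - s)) * φ v)
      (Real.exp (q * (u - s)) * q * φ u + Real.exp (q * (u - s)) * G u) (Ici u) u :=
    fun u hu => (hexp u).hasDerivWithinAt.mul (hderiv u hu)
  have hφc : ContinuousOn φ (Icc (s : ℝ) t) := by
    have h1 : Continuous fun u => φ s + ∫ v in (s : ℝ)..u, G v :=
      continuous_const.add (intervalIntegral.continuous_primitive hGi _)
    exact h1.continuousOn.congr fun u hu => hφeq u hu.1
  have hlin : ∀ u : ℝ, HasDerivAt (fun v : ℝ => φ s + (v - s) * (l * m)) (l * m) u := by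
    intro u
    have := (((hasDerivAt_id u).sub_const (s : ℝ)).mul_const (l * m)).const_add (φ s)
    simpa using this
  have hmain := image_le_of_deriv_right_le_deriv_boundary (a := (s : ℝ)) (b := t)
    (f := fun v : ℝ => φ s + (v - s) * (l * m)) (f' := fun _ => l * m)
    (B := fun v => Real.exp (q * (v - s)) * φ v)
    (fun u _ => (hlin u).continuousAt.continuousWithinAt)
    (fun u _ => (hlin u).hasDerivWithinAt) (by simp)
    ((Real.continuous_exp.comp
      (by fun_prop : Continuous fun v : ℝ => q * (v - s))).continuousOn.mul hφc) (fun u hu => hψ u hu.1) (fun u hu => ?_) (right_mem_Icc.mpr hst)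
  · simpa [hφ] using hmain
  · have h1 : l * (∫ ω in A, pointIndicator a (X u.toNNReal ω) ∂P) - q * φ u ≤ G u := by
      rw [hφ, hG, ← integral_const_mul, ← integral_const_mul,
        ← integral_sub ((hint a u).const_mul l) ((hint b u).const_mul q)]
      exact integral_mono (((hint a u).const_mul l).sub ((hint b u).const_mul q))
        (integrable_comp_of_bounded (hX.measurable _) hK).integrableOn fun ω => hlow _
    have h2 := mul_le_mul_of_nonneg_left (ha u hu.1) hl
    have h3 := mul_le_mul_of_nonneg_left h1 (Real.exp_pos (q * (u - s))).le
    nlinarith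

/-- A lower bound on the transition probabilities in terms of the generator: at most one jump
of a uniformizing clock of rate `q` is taken into account. -/
theorem IsProcessWithGenerator.measure_inter_ge (hX : IsProcessWithGenerator P L X)
    {a b : Config k N} (hLa : (Function.support (L (pointIndicator a))).Finite)
    (hLb : (Function.support (L (pointIndicator b))).Finite)
    (hna : ∀ x, x ≠ a → 0 ≤ L (pointIndicator a) x)
    (hnb : ∀ x, x ≠ b → 0 ≤ L (pointIndicator b) x)
    {q : ℝ} (hq : 0 ≤ q) (hqa : -q ≤ L (pointIndicator a) a) (hqb : -q ≤ L (pointIndicator b) b)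
    {s h : ℝ≥0} {A : Set Ω}
    (hA : MeasurableSet[hX.filtration s] A)
    (hAa : ∀ ω ∈ A, X s ω = a) :
    ENNReal.ofReal (Real.exp (-(q * h)) * (1 + q * h) *
      (pointIndicator b a + h / (1 + q * h) * L (pointIndicator b) a)) * P A ≤
      P (A ∩ {ω | X (s + h) ω = b}) := by
  have hAm : MeasurableSet A := hX.filtration.le s A hA
  have hpt : ∀ (c : Config k N) (r : ℝ≥0),
      ∫ ω in A, pointIndicator c (X r ω) ∂P = P.real (A ∩ {ω | X r ω = c}) := by
    intro c r
    have hms : MeasurableSet {ω | X r ω = c} := hX.measurable r (measurableSet_singleton c)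
    have : (fun ω => pointIndicator c (X r ω)) = indicator {ω | X r ω = c} 1 := by
      ext ω
      by_cases hω : X r ω = c
      · simp [pointIndicator, hω]
      · simp [pointIndicator, hω]
    rw [this, integral_indicator_one hms, measureReal_restrict_apply hms, inter_comm]
  have hAs : A ∩ {ω | X s ω = a} = A := inter_eq_left.mpr hAa
  -- The probability of staying at `a`, from the case `b = a`, `l = 0`. It serves as the lower bound
  -- `m = P A` in the second application, which allows for one jump from `a` to `b`.
  have h1 : ∀ t : ℝ, (s : ℝ) ≤ t → P.real A ≤
      Real.exp (q * (t - s)) * ∫ ω in A, pointIndicator a (X t.toNNReal ω) ∂P := by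
    intro t ht
    have := hX.exp_mul_setIntegral_ge (a := a) (m := 0) hLa le_rfl (q := q) (fun x => ?_) hA
      (fun t _ => mul_nonneg (Real.exp_pos _).le ?_) ht
    · rw [hpt, hAs] at this
      simpa using this
    · by_cases hx : x = a
      · subst hx; simpa [pointIndicator_self] using hqa
      · simpa [pointIndicator_of_ne hx] using hna x hx
    · rw [hpt]; exact measureReal_nonneg
  have hl : 0 ≤ L (pointIndicator b) a + q * pointIndicator b a := by
    by_cases hab : a = b
    · subst hab; rw [pointIndicator_self]; linarith
    · rw [pointIndicator_of_ne hab]; simpa using hnb a hab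
  have h2 := hX.exp_mul_setIntegral_ge (a := a) hLb hl (q := q) (fun x => ?_) hA h1
    (t := s + h) (by simp)
  · have e1 : ((s : ℝ) + h).toNNReal = s + h := by
      rw [← NNReal.coe_add, Real.toNNReal_coe]
    have e2 : ∫ ω in A, pointIndicator b (X s ω) ∂P = pointIndicator b a * P.real A := by
      rw [setIntegral_congr_fun hAm (g := fun _ => pointIndicator b a)
        (fun ω hω => by simp only [hAa ω hω])]
      simp [mul_comm]
    rw [e1, e2, hpt, add_sub_cancel_left] at h2
    have hqh : 0 < 1 + q * h := by positivity
    have h3 : Real.exp (-(q * h)) * (1 + q * h) *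
        (pointIndicator b a + h / (1 + q * h) * L (pointIndicator b) a) * P.real A ≤
        P.real (A ∩ {ω | X (s + h) ω = b}) := by
      have e3 : Real.exp (-(q * h)) * Real.exp (q * h) = 1 := by
        rw [← Real.exp_add]; simp
      have h4 := mul_le_mul_of_nonneg_left h2 (Real.exp_pos (-(q * h))).le
      rw [← mul_assoc (Real.exp (-(q * h))) (Real.exp (q * h)), e3, one_mul] at h4
      refine le_trans (le_of_eq ?_) h4
      field_simp
      ring
    rw [← ofReal_measureReal, ← ofReal_measureReal, ← ENNReal.ofReal_mul' measureReal_nonneg]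
    exact ENNReal.ofReal_le_ofReal h3
  · by_cases hxa : x = a
    · subst hxa; rw [pointIndicator_self]; linarith
    · rw [pointIndicator_of_ne hxa]
      by_cases hxb : x = b
      · subst hxb; rw [pointIndicator_self]; linarith
      · rw [pointIndicator_of_ne hxb]; simpa using hnb x hxb

end Transition

/-! ### Gluing a coupling of discrete marginals -/

theorem inv_smul_smul_of_measure_univ {C : Type*} [MeasurableSpace C] {ρ : Measure C} {d : ℝ≥0∞}
    (hd : d ≠ ∞) (hρ : ρ univ = d) : d⁻¹ • d • ρ = ρ := by
  by_cases h0 : d = 0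
  · rw [h0] at hρ
    rw [Measure.measure_univ_eq_zero.mp hρ]; simp
  · rw [smul_smul, ENNReal.inv_mul_cancel h0 hd, one_smul]

/-- A sub-coupling of two probability measures can be completed to a coupling. -/
theorem exists_coupling_ge {A B : Type*} [MeasurableSpace A] [MeasurableSpace B]
    {α : Measure A} {β : Measure B} [IsProbabilityMeasure α]
    [IsProbabilityMeasure β] {γ : Measure (A × B)} (h₁ : γ.map Prod.fst ≤ α)
    (h₂ : γ.map Prod.snd ≤ β) :
    ∃ γ' : Measure (A × B), γ'.map Prod.fst = α ∧ γ'.map Prod.snd = β ∧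
      ∀ S, γ' S ≤ γ S + (1 - γ univ) := by
  have hγ1 : γ.map Prod.fst univ = γ univ := by
    rw [Measure.map_apply measurable_fst MeasurableSet.univ, preimage_univ]
  have hγ2 : γ.map Prod.snd univ = γ univ := by
    rw [Measure.map_apply measurable_snd MeasurableSet.univ, preimage_univ]
  have hγle : γ univ ≤ 1 := by
    rw [← hγ1, ← measure_univ (μ := α)]; exact h₁ _
  have : IsFiniteMeasure γ := ⟨hγle.trans_lt ENNReal.one_lt_top⟩
  set d := 1 - γ univ with hd
  have hdtop : d ≠ ∞ := ne_top_of_le_ne_top ENNReal.one_ne_top tsub_le_self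
  have hd1 : (α - γ.map Prod.fst) univ = d := by
    rw [Measure.sub_apply MeasurableSet.univ h₁, measure_univ, hγ1]
  have hd2 : (β - γ.map Prod.snd) univ = d := by
    rw [Measure.sub_apply MeasurableSet.univ h₂, measure_univ, hγ2]
  -- The missing mass `d` is filled in independently. If `d = 0` then `d⁻¹ = ∞`, but the product
  -- measure vanishes.
  refine ⟨γ + d⁻¹ • ((α - γ.map Prod.fst).prod (β - γ.map Prod.snd)), ?_, ?_, ?_⟩
  · rw [Measure.map_add _ _ measurable_fst, Measure.map_smul, Measure.map_fst_prod, hd2,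
      inv_smul_smul_of_measure_univ hdtop hd1, add_comm, Measure.sub_add_cancel_of_le h₁]
  · rw [Measure.map_add _ _ measurable_snd, Measure.map_smul, Measure.map_snd_prod, hd1,
      inv_smul_smul_of_measure_univ hdtop hd2, add_comm, Measure.sub_add_cancel_of_le h₂]
  · intro S
    rw [Measure.add_apply, Measure.smul_apply, smul_eq_mul]
    refine add_le_add le_rfl ?_
    refine (mul_le_mul_right (measure_mono (subset_univ S)) _).trans ?_
    rw [← univ_prod_univ, Measure.prod_prod, hd1, hd2, ← mul_assoc]
    exact mul_le_of_le_one_left bot_le (ENNReal.inv_mul_le_one d)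

section Gluing

variable {E₁ E₂ A B : Type*} [MeasurableSpace E₁] [MeasurableSpace E₂]
  [MeasurableSpace A] [MeasurableSpace B] [Countable A] [Countable B]
  [DiscreteMeasurableSpace A] [DiscreteMeasurableSpace B]

/-- The density, with respect to the product measure, of the coupling that makes two random
variables conditionally independent given their discretizations. -/
def gluingDensity (α : Measure A) (β : Measure B) (γ : Measure (A × B)) (p : A × B) : ℝ≥0∞ :=
  γ {p} / (α {p.1} * β {p.2})

theorem lintegral_gluingDensity {α : Measure A} {β : Measure B} {γ : Measure (A × B)}
    [IsProbabilityMeasure α] [IsProbabilityMeasure β]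
    (h₁ : γ.map Prod.fst = α) (h₂ : γ.map Prod.snd = β) {a : A} (ha : α {a} ≠ 0) :
    ∫⁻ b, gluingDensity α β γ (a, b) ∂β = 1 := by
  rw [lintegral_countable']
  have h3 : ∀ b, gluingDensity α β γ (a, b) * β {b} = γ {(a, b)} * (α {a})⁻¹ := by
    intro b
    unfold gluingDensity
    by_cases hb : β {b} = 0
    -- Where `β {b} = 0` the numerator of the density vanishes as well, and `0 / 0 = 0`.
    · have : γ {(a, b)} = 0 := by
        refine measure_mono_null (t := Prod.snd ⁻¹' {b}) (by simp) ?_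
        rw [← Measure.map_apply measurable_snd (measurableSet_singleton b), h₂, hb]
      simp [hb, this]
    · rw [ENNReal.div_eq_inv_mul, ENNReal.mul_inv (Or.inl ha) (Or.inr hb)]
      have := ENNReal.inv_mul_cancel hb (measure_ne_top β {b})
      calc _ = (α {a})⁻¹ * ((β {b})⁻¹ * β {b}) * γ {(a, b)} := by ring
        _ = _ := by rw [this, mul_one, mul_comm]
  simp_rw [h3]
  rw [ENNReal.tsum_mul_right]
  have h4 : ∑' b, γ {(a, b)} = α {a} := by
    rw [← h₁, Measure.map_apply measurable_fst (measurableSet_singleton a)]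
    have : (Prod.fst ⁻¹' {a} : Set (A × B)) = ⋃ b, {(a, b)} := by
      ext ⟨x, y⟩; simp [eq_comm]
    rw [this, measure_iUnion (fun b b' hbb => by simpa using hbb)
      (fun b => measurableSet_singleton _)]
  rw [h4, ENNReal.mul_inv_cancel ha (measure_ne_top _ _)]

/-- A sub-coupling of the laws of two discrete random variables extends to a coupling of the
measures on which they are defined. -/
theorem exists_coupling_of_discrete (μ : Measure E₁) (ν : Measure E₂) [IsProbabilityMeasure μ]
    [IsProbabilityMeasure ν] {f : E₁ → A} {g : E₂ → B} (hf : Measurable f) (hg : Measurable g)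
    {γ : Measure (A × B)} (h₁ : γ.map Prod.fst ≤ μ.map f) (h₂ : γ.map Prod.snd ≤ ν.map g) :
    ∃ R : Measure (E₁ × E₂), R.map Prod.fst = μ ∧ R.map Prod.snd = ν ∧
      ∀ S, R {e | (f e.1, g e.2) ∈ S} ≤ γ S + (1 - γ univ) := by
  have := Measure.isProbabilityMeasure_map (μ := μ) hf.aemeasurable
  have := Measure.isProbabilityMeasure_map (μ := ν) hg.aemeasurable
  obtain ⟨γ', h₁', h₂', hγ'⟩ := exists_coupling_ge h₁ h₂
  set α := μ.map f
  set β := ν.map g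
  have hdm : Measurable fun e : E₁ × E₂ => gluingDensity α β γ' (f e.1, g e.2) :=
    (Measurable.of_discrete (f := gluingDensity α β γ')).comp
      ((hf.comp measurable_fst).prodMk (hg.comp measurable_snd))
  have hint1 : ∀ᵐ x ∂μ, ∫⁻ y, gluingDensity α β γ' (f x, g y) ∂ν = 1 := by
    have h0 : ∀ᵐ a ∂α, α {a} ≠ 0 := by
      rw [ae_iff_of_countable]; exact fun a ha => ha
    filter_upwards [ae_of_ae_map hf.aemeasurable h0] with x hx
    rw [← lintegral_map (f := fun b => gluingDensity α β γ' (f x, b)) Measurable.of_discrete hg]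
    exact lintegral_gluingDensity h₁' h₂' hx
  have hint2 : ∀ᵐ y ∂ν, ∫⁻ x, gluingDensity α β γ' (f x, g y) ∂μ = 1 := by
    have h0 : ∀ᵐ b ∂β, β {b} ≠ 0 := by
      rw [ae_iff_of_countable]; exact fun a ha => ha
    filter_upwards [ae_of_ae_map hg.aemeasurable h0] with y hy
    rw [← lintegral_map (f := fun a => gluingDensity α β γ' (a, g y)) Measurable.of_discrete hf]
    have hs1 : (γ'.map Prod.swap).map Prod.fst = β := by
      rw [Measure.map_map measurable_fst measurable_swap]; exact h₂'
    have hs2 : (γ'.map Prod.swap).map Prod.snd = α := by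
      rw [Measure.map_map measurable_snd measurable_swap]; exact h₁'
    rw [← lintegral_gluingDensity hs1 hs2 hy]
    refine lintegral_congr fun a => ?_
    simp only [gluingDensity]
    rw [Measure.map_apply measurable_swap (measurableSet_singleton _), mul_comm]
    congr 2
    ext ⟨x, z⟩
    simp [and_comm]
  refine ⟨(μ.prod ν).withDensity fun e => gluingDensity α β γ' (f e.1, g e.2), ?_, ?_, ?_⟩
  · ext S hS
    rw [Measure.map_apply measurable_fst hS, withDensity_apply _ (measurable_fst hS),
      ← prod_univ, ← Measure.prod_restrict, lintegral_prod _ hdm.aemeasurable,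
      Measure.restrict_univ, lintegral_congr_ae (ae_restrict_of_ae hint1)]
    simp
  · ext S hS
    rw [Measure.map_apply measurable_snd hS, withDensity_apply _ (measurable_snd hS),
      ← univ_prod, ← Measure.prod_restrict, lintegral_prod_symm _ hdm.aemeasurable,
      Measure.restrict_univ, lintegral_congr_ae (ae_restrict_of_ae hint2)]
    simp
  · intro S
    refine le_trans ?_ (hγ' S)
    have hfg : Measurable (Prod.map f g) := hf.prodMap hg
    have hset : {e : E₁ × E₂ | (f e.1, g e.2) ∈ S} = Prod.map f g ⁻¹' S := rfl
    have hSm : MeasurableSet S := MeasurableSet.of_discrete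
    rw [hset, withDensity_apply _ (hfg hSm)]
    change ∫⁻ e in Prod.map f g ⁻¹' S, gluingDensity α β γ' (Prod.map f g e) ∂_ ≤ _
    rw [← setLIntegral_map hSm Measurable.of_discrete hfg, ← Measure.map_prod_map _ _ hf hg,
      lintegral_countable']
    have hS' : γ' S = ∑' p, (γ'.restrict S) {p} := by
      rw [← Measure.restrict_apply_univ, ← lintegral_one, lintegral_countable']
      simp
    rw [hS']
    refine ENNReal.tsum_le_tsum fun p => ?_
    rw [Measure.restrict_apply (measurableSet_singleton p),
      Measure.restrict_apply (measurableSet_singleton p)]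
    by_cases hp : p ∈ S
    · rw [inter_eq_left.mpr (singleton_subset_iff.mpr hp), gluingDensity, ← Prod.mk.eta (p := p),
        ← singleton_prod_singleton, Measure.prod_prod]
      rw [mul_comm]; exact ENNReal.mul_div_le
    · rw [singleton_inter_eq_empty.mpr hp]; simp

end Gluing

/-! ### Discrete-time chains driven by finitely many moves -/

section Chain

variable {Z ι : Type*} [MeasurableSpace Z] [Fintype ι] (rate : ι → Z → ℝ≥0) (act : ι → Z → Z)
  (ε : ℝ≥0)

/-- The move `i` is made with probability `ε` times its rate. -/
def moveKernel (z : Z) : Measure Z :=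
  ((1 - ε * ∑ i, rate i z : ℝ≥0) : ℝ≥0∞) • Measure.dirac z +
    ∑ i, ((ε * rate i z : ℝ≥0) : ℝ≥0∞) • Measure.dirac (act i z)

variable [DiscreteMeasurableSpace Z]

theorem lintegral_moveKernel (F : Z → ℝ≥0∞) (z : Z) :
    ∫⁻ w, F w ∂moveKernel rate act ε z =
      ((1 - ε * ∑ i, rate i z : ℝ≥0) : ℝ≥0∞) * F z +
        ∑ i, ((ε * rate i z : ℝ≥0) : ℝ≥0∞) * F (act i z) := by
  simp [moveKernel, lintegral_add_measure, lintegral_finsetSum_measure]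

variable {rate act ε}

theorem lintegral_moveKernel_le {F : Z → ℝ≥0∞} {z : Z} (hε : ε * ∑ i, rate i z ≤ 1)
    (d : ι → ℝ≥0∞) (hd : ∀ i, rate i z ≠ 0 → F (act i z) ≤ F z + d i) :
    ∫⁻ w, F w ∂moveKernel rate act ε z ≤
      F z + ∑ i, ((ε * rate i z : ℝ≥0) : ℝ≥0∞) * d i := by
  rw [lintegral_moveKernel]
  have h1 : ∀ i, ((ε * rate i z : ℝ≥0) : ℝ≥0∞) * F (act i z) ≤
      ((ε * rate i z : ℝ≥0) : ℝ≥0∞) * F z + ((ε * rate i z : ℝ≥0) : ℝ≥0∞) * d i := by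
    intro i
    rw [← mul_add]
    by_cases hi : rate i z = 0
    · simp [hi]
    · exact mul_le_mul_right (hd i hi) _
  refine (add_le_add le_rfl (Finset.sum_le_sum fun i _ => h1 i)).trans (le_of_eq ?_)
  rw [Finset.sum_add_distrib, ← add_assoc, ← Finset.sum_mul, ← add_mul]
  congr 1
  have h2 : ((1 - ε * ∑ i, rate i z : ℝ≥0) : ℝ≥0∞) + ∑ i, ((ε * rate i z : ℝ≥0) : ℝ≥0∞) = 1 := by
    rw [← ENNReal.ofNNReal_finsetSum, ← ENNReal.coe_add, ← Finset.mul_sum, tsub_add_cancel_of_le hε,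
      ENNReal.coe_one]
  rw [h2, one_mul]

theorem lintegral_ofReal_moveKernel {f : Z → ℝ} (hf : ∀ z, 0 ≤ f z) {z : Z}
    (hε : ε * ∑ i, rate i z ≤ 1) :
    ∫⁻ w, ENNReal.ofReal (f w) ∂moveKernel rate act ε z =
      ENNReal.ofReal (f z + ε * ∑ i, rate i z * (f (act i z) - f z)) := by
  rw [lintegral_moveKernel]
  have h1 : ∀ (r : ℝ≥0) (x : ℝ), (r : ℝ≥0∞) * ENNReal.ofReal x = ENNReal.ofReal (r * x) := by
    intro r x
    rw [ENNReal.ofReal_mul (NNReal.coe_nonneg r), ENNReal.ofReal_coe_nnreal]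
  simp_rw [h1]
  rw [← ENNReal.ofReal_sum_of_nonneg fun i _ => mul_nonneg (NNReal.coe_nonneg _) (hf _),
    ← ENNReal.ofReal_add (mul_nonneg (NNReal.coe_nonneg _) (hf _))
      (Finset.sum_nonneg fun i _ => mul_nonneg (NNReal.coe_nonneg _) (hf _))]
  congr 1
  rw [NNReal.coe_sub hε]
  push_cast
  simp only [mul_sub, Finset.sum_sub_distrib, Finset.mul_sum, Finset.sum_mul, sub_mul]
  have e : ∀ i, (ε : ℝ) * rate i z * f (act i z) = ε * (rate i z * f (act i z)) :=
    fun i => by ring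
  have e' : ∀ i, (ε : ℝ) * rate i z * f z = ε * (rate i z * f z) := fun i => by ring
  simp only [e, e']
  ring

theorem ae_moveKernel {Q : Z → Prop} {z : Z} (hz : Q z)
    (h : ∀ i, rate i z ≠ 0 → Q (act i z)) : ∀ᵐ w ∂moveKernel rate act ε z, Q w := by
  rw [ae_iff, ← lintegral_indicator_one MeasurableSet.of_discrete, lintegral_moveKernel]
  simp only [add_eq_zero, mul_eq_zero, Finset.sum_eq_zero_iff, Finset.mem_univ, true_imp_iff]
  refine ⟨Or.inr (by simp [hz]), fun i => ?_⟩
  by_cases hi : rate i z = 0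
  · left; simp [hi]
  · right; simp [h i hi]

variable [Countable Z] (κ : Z → Measure Z) (ρ : Measure Z)

/-- The law of the first `n + 1` states of the Markov chain with kernel `κ` and initial
distribution `ρ`. -/
def chainLaw : (n : ℕ) → Measure (Fin (n + 1) → Z)
  | 0 => ρ.map fun z _ => z
  | n + 1 => (chainLaw n).bind fun p => (κ (p (Fin.last n))).map fun z =>
      (Fin.snoc (α := fun _ => Z) p z : Fin (n + 2) → Z)

theorem lintegral_chainLaw_zero (F : (Fin 1 → Z) → ℝ≥0∞) :
    ∫⁻ p, F p ∂chainLaw κ ρ 0 = ∫⁻ z, F (fun _ => z) ∂ρ :=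
  lintegral_map Measurable.of_discrete Measurable.of_discrete

theorem lintegral_chainLaw_succ (n : ℕ) (F : (Fin (n + 2) → Z) → ℝ≥0∞) :
    ∫⁻ p, F p ∂chainLaw κ ρ (n + 1) =
      ∫⁻ p, ∫⁻ z, F (Fin.snoc (α := fun _ => Z) p z) ∂κ (p (Fin.last n)) ∂chainLaw κ ρ n := by
  rw [chainLaw, Measure.lintegral_bind Measurable.of_discrete.aemeasurable
    Measurable.of_discrete.aemeasurable]
  refine lintegral_congr fun p => ?_
  exact lintegral_map Measurable.of_discrete Measurable.of_discrete

theorem lintegral_last_chainLaw_le {F : Z → ℝ≥0∞} {c : ℝ≥0∞}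
    (h : ∀ z, ∫⁻ w, F w ∂κ z ≤ c * F z) (n : ℕ) :
    ∫⁻ p, F (p (Fin.last n)) ∂chainLaw κ ρ n ≤ c ^ n * ∫⁻ z, F z ∂ρ := by
  induction n with
  | zero => rw [lintegral_chainLaw_zero]; simp
  | succ n ih =>
    rw [lintegral_chainLaw_succ]
    simp only [Fin.snoc_last]
    calc _ ≤ ∫⁻ p, c * F (p (Fin.last n)) ∂chainLaw κ ρ n := lintegral_mono fun p => h _
      _ = c * ∫⁻ p, F (p (Fin.last n)) ∂chainLaw κ ρ n :=
          lintegral_const_mul _ Measurable.of_discrete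
      _ ≤ c * (c ^ n * ∫⁻ z, F z ∂ρ) := mul_le_mul_right ih _
      _ = _ := by ring

theorem chainLaw_univ [IsProbabilityMeasure ρ] (h : ∀ z, κ z univ = 1) (n : ℕ) :
    chainLaw κ ρ n univ = 1 := by
  induction n with
  | zero =>
    rw [← lintegral_one, lintegral_chainLaw_zero, lintegral_one, measure_univ]
  | succ n ih =>
    rw [← lintegral_one, lintegral_chainLaw_succ]
    simp [h, ih]

theorem ae_chainLaw {Q : (n : ℕ) → (Fin (n + 1) → Z) → Prop}
    (h0 : ∀ᵐ z ∂ρ, Q 0 fun _ => z)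
    (h1 : ∀ n p, Q n p → ∀ᵐ z ∂κ (p (Fin.last n)), Q (n + 1) (Fin.snoc (α := fun _ => Z) p z))
    (n : ℕ) : ∀ᵐ p ∂chainLaw κ ρ n, Q n p := by
  have key : ∀ n, (∀ᵐ p ∂chainLaw κ ρ n, Q n p) ↔
      ∫⁻ p, indicator {p | ¬ Q n p} 1 p ∂chainLaw κ ρ n = 0 := by
    intro n
    rw [ae_iff, lintegral_indicator_one MeasurableSet.of_discrete]
  induction n with
  | zero =>
    rw [key, lintegral_chainLaw_zero, lintegral_eq_zero_iff Measurable.of_discrete]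
    filter_upwards [h0] with z hz
    simp [hz]
  | succ n ih =>
    rw [key, lintegral_chainLaw_succ, lintegral_eq_zero_iff Measurable.of_discrete]
    filter_upwards [ih] with p hp
    rw [Pi.zero_apply, lintegral_eq_zero_iff Measurable.of_discrete]
    filter_upwards [h1 n p hp] with z hz
    simp [hz]

/-- If the one-step probabilities of a coordinate of the chain, while the chain is in a good set,
are dominated by those of a family of laws, then so are those of the trajectories. -/
theorem pow_mul_chainLaw_le {C : Type*} {pr : Z → C} {G : Z → Prop} {K : Set C}
    (hGK : ∀ z, G z → pr z ∈ K) (hfrozen : ∀ z, ¬ G z → ∀ᵐ w ∂κ z, ¬ G w)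
    {w : C → C → ℝ≥0∞} (hw : ∀ z, G z → ∀ b, κ z {z' | pr z' = b} ≤ w (pr z) b)
    {c : ℝ≥0∞} {ν : (n : ℕ) → (Fin (n + 1) → C) → ℝ≥0∞}
    (hν0 : ∀ a, ρ {z | (fun _ => pr z) = a} ≤ ν 0 a)
    (hν : ∀ n a b, a (Fin.last n) ∈ K → b ∈ K →
      c * w (a (Fin.last n)) b * ν n a ≤ ν (n + 1) (Fin.snoc (α := fun _ => C) a b))
    (n : ℕ) (a : Fin (n + 1) → C) :
    c ^ n * chainLaw κ ρ n {p | pr ∘ p = a ∧ G (p (Fin.last n))} ≤ ν n a := by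
  have hint : ∀ n a, chainLaw κ ρ n {p | pr ∘ p = a ∧ G (p (Fin.last n))} =
      ∫⁻ p, indicator {p | pr ∘ p = a ∧ G (p (Fin.last n))} 1 p ∂chainLaw κ ρ n :=
    fun n a => (lintegral_indicator_one MeasurableSet.of_discrete).symm
  induction n with
  | zero =>
    rw [hint, lintegral_chainLaw_zero, pow_zero, one_mul]
    refine le_trans ?_ (hν0 a)
    rw [← lintegral_indicator_one MeasurableSet.of_discrete]
    refine lintegral_mono fun z => ?_
    refine indicator_le_indicator_of_subset
      (s := {z | pr ∘ (fun _ : Fin 1 => z) = a ∧ G z})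
      (t := {z | (fun _ : Fin 1 => pr z) = a}) (f := 1) (fun z hz => hz.1) (fun _ => bot_le) z
  | succ n ih =>
    obtain ⟨a, b, rfl⟩ : ∃ a' b, a = Fin.snoc (α := fun _ => C) a' b :=
      ⟨Fin.init a, a (Fin.last _), (Fin.snoc_init_self a).symm⟩
    have hmem : ∀ (p : Fin (n + 1) → Z) (z : Z),
        (pr ∘ (Fin.snoc (α := fun _ => Z) p z : Fin (n + 2) → Z) =
          Fin.snoc (α := fun _ => C) a b) ↔ pr ∘ p = a ∧ pr z = b := by
      intro p z
      rw [Fin.comp_snoc, Fin.snoc_inj]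
    -- Bad states are absorbing, so a good final state forces a good previous one almost surely.
    -- Both projections then lie in `K`; otherwise the event is null and nothing is asked of `ν`.
    by_cases hab : a (Fin.last n) ∈ K ∧ b ∈ K
    · refine le_trans ?_ (hν n a b hab.1 hab.2)
      rw [hint, lintegral_chainLaw_succ]
      have hle : ∀ p : Fin (n + 1) → Z, ∫⁻ z, indicator {p : Fin (n + 2) → Z |
          pr ∘ p = Fin.snoc (α := fun _ => C) a b ∧ G (p (Fin.last (n + 1)))} 1
            (Fin.snoc (α := fun _ => Z) p z) ∂κ (p (Fin.last n)) ≤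
          w (a (Fin.last n)) b * indicator {p | pr ∘ p = a ∧ G (p (Fin.last n))} 1 p := by
        intro p
        by_cases hG : G (p (Fin.last n))
        · by_cases hp : pr ∘ p = a
          · rw [indicator_of_mem (show p ∈ {p | pr ∘ p = a ∧ G (p (Fin.last n))} from ⟨hp, hG⟩),
              Pi.one_apply, mul_one]
            have e : a (Fin.last n) = pr (p (Fin.last n)) := by rw [← hp]; rfl
            rw [e]
            refine le_trans ?_ (hw _ hG b)
            rw [← lintegral_indicator_one MeasurableSet.of_discrete]
            refine lintegral_mono fun z => ?_
            by_cases hz : pr z = b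
            · rw [indicator_of_mem (show z ∈ {z | pr z = b} from hz)]
              exact indicator_le_self' (fun _ _ => bot_le) _
            · rw [indicator_of_notMem]
              · exact bot_le
              · exact fun h => hz ((hmem p z).mp h.1).2
          · refine le_trans (le_of_eq (b := 0) ?_) zero_le
            rw [lintegral_eq_zero_iff Measurable.of_discrete]
            refine Eventually.of_forall fun z => indicator_of_notMem (fun h => ?_) _
            exact hp ((hmem p z).mp h.1).1
        · refine le_trans (le_of_eq (b := 0) ?_) zero_le
          rw [lintegral_eq_zero_iff Measurable.of_discrete]
          filter_upwards [hfrozen _ hG] with z hz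
          refine indicator_of_notMem (fun h => hz ?_) _
          have := h.2
          rwa [Fin.snoc_last] at this
      calc _ ≤ c ^ (n + 1) * ∫⁻ p, w (a (Fin.last n)) b *
            indicator {p | pr ∘ p = a ∧ G (p (Fin.last n))} 1 p ∂chainLaw κ ρ n :=
          mul_le_mul_right (lintegral_mono hle) _
        _ = c * w (a (Fin.last n)) b *
            (c ^ n * chainLaw κ ρ n {p | pr ∘ p = a ∧ G (p (Fin.last n))}) := by
          rw [lintegral_const_mul _ Measurable.of_discrete, ← hint]; ring
        _ ≤ _ := mul_le_mul_right (ih a) _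
    · refine le_trans (le_of_eq (b := 0) ?_) zero_le
      rw [hint, lintegral_chainLaw_succ]
      refine mul_eq_zero_of_right _ ?_
      rw [lintegral_eq_zero_iff Measurable.of_discrete]
      refine Eventually.of_forall fun p => ?_
      rw [Pi.zero_apply, lintegral_eq_zero_iff Measurable.of_discrete]
      by_cases hG : G (p (Fin.last n))
      · refine Eventually.of_forall fun z => indicator_of_notMem (fun h => hab ?_) _
        obtain ⟨h1, h2⟩ := (hmem p z).mp h.1
        have h3 := h.2
        rw [Fin.snoc_last] at h3
        refine ⟨?_, h2 ▸ hGK _ h3⟩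
        rw [← h1]; exact hGK _ hG
      · filter_upwards [hfrozen _ hG] with z hz
        refine indicator_of_notMem (fun h => hz ?_) _
        have := h.2
        rwa [Fin.snoc_last] at this

end Chain

/-! ### Effect of the moves on configurations -/

theorem coe_down_apply (η : Config k N) (x z : ↥(bulk N)) :
    (down η x z : ℕ) = if z = x then (η x : ℕ) - 1 else η z := by
  by_cases h : z = x
  · subst h; simp [down]
  · simp [down, h]

theorem coe_up_apply {η : Config k N} {x : ↥(bulk N)} (h : ((η x : ℕ) : ℕ∞) < k)
    (z : ↥(bulk N)) : (up η x z : ℕ) = if z = x then (η x : ℕ) + 1 else η z := by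
  rw [up, dif_pos h]
  by_cases hz : z = x
  · subst hz; simp
  · simp [hz]

theorem up_eq_self {η : Config k N} {x : ↥(bulk N)} (h : ¬ ((η x : ℕ) : ℕ∞) < k) :
    up η x = η := dif_neg h

theorem jump_eq_self {η : Config k N} {x y : ↥(bulk N)}
    (h : (η x : ℕ) = 0 ∨ ((η y : ℕ) : ℕ∞) = k) : jump η x y = η := if_pos h

theorem jump_self (η : Config k N) (x : ↥(bulk N)) : jump η x x = η := by
  by_cases h : (η x : ℕ) = 0 ∨ ((η x : ℕ) : ℕ∞) = k
  · exact jump_eq_self h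
  · rw [jump, if_neg h]
    push Not at h
    have e : (down η x x : ℕ) = η x - 1 := by rw [coe_down_apply, if_pos rfl]
    have h1 : ((down η x x : ℕ) : ℕ∞) < k := by
      refine lt_of_lt_of_le ?_ (η x).2
      rw [e]
      exact_mod_cast Nat.sub_lt (Nat.pos_of_ne_zero h.1) one_pos
    funext z
    apply Subtype.ext
    rw [coe_up_apply h1, coe_down_apply, coe_down_apply, if_pos rfl]
    split_ifs with hz
    · subst hz; have := h.1; omega
    · rfl

theorem coe_jump_apply {η : Config k N} {x y : ↥(bulk N)} (hxy : x ≠ y) (hx : (η x : ℕ) ≠ 0)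
    (hy : ((η y : ℕ) : ℕ∞) ≠ k) (z : ↥(bulk N)) :
    (jump η x y z : ℕ) = if z = y then (η y : ℕ) + 1 else if z = x then (η x : ℕ) - 1 else η z := by
  have e : (down η x y : ℕ) = η y := by rw [coe_down_apply, if_neg hxy.symm]
  have h1 : ((down η x y : ℕ) : ℕ∞) < k := by
    rw [e]; exact lt_of_le_of_ne (η y).2 hy
  rw [jump, if_neg (by push Not; exact ⟨hx, hy⟩), coe_up_apply h1, e, coe_down_apply]

/-- The effect of changing one summand, written without the truncated subtraction of natural
numbers. -/
theorem sum_add_eq_sum_add {α : Type*} [Fintype α] [DecidableEq α] {f g : α → ℕ} (x : α)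
    (h : ∀ z, z ≠ x → f z = g z) : ∑ z, f z + g x = ∑ z, g z + f x := by
  rw [← Finset.add_sum_erase _ f (Finset.mem_univ x),
    ← Finset.add_sum_erase _ g (Finset.mem_univ x),
    Finset.sum_congr rfl fun z hz => h z (Finset.ne_of_mem_erase hz)]
  ring

theorem sum_add_add_eq_sum_add_add {α : Type*} [Fintype α] [DecidableEq α] {f g : α → ℕ} {x y : α}
    (hxy : x ≠ y) (h : ∀ z, z ≠ x → z ≠ y → f z = g z) :
    ∑ z, f z + (g x + g y) = ∑ z, g z + (f x + f y) := by
  have hy : y ∈ Finset.univ.erase x := Finset.mem_erase.mpr ⟨hxy.symm, Finset.mem_univ y⟩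
  rw [← Finset.add_sum_erase _ f (Finset.mem_univ x),
    ← Finset.add_sum_erase _ g (Finset.mem_univ x),
    ← Finset.add_sum_erase _ f hy, ← Finset.add_sum_erase _ g hy,
    Finset.sum_congr rfl fun z hz => h z (Finset.ne_of_mem_erase (Finset.mem_of_mem_erase hz))
      (Finset.ne_of_mem_erase hz)]
  ring

theorem count_jump (η : Config k N) (x y : ↥(bulk N)) : count (jump η x y) = count η := by
  by_cases h : (η x : ℕ) = 0 ∨ ((η y : ℕ) : ℕ∞) = k
  · rw [jump_eq_self h]
  by_cases hxy : x = y
  · subst hxy; rw [jump_self]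
  push Not at h
  have hj := coe_jump_apply hxy h.1 h.2
  have := sum_add_add_eq_sum_add_add (f := fun z => (jump η x y z : ℕ)) (g := fun z => (η z : ℕ))
    hxy (fun z h1 h2 => by simp only [hj, if_neg h1, if_neg h2])
  simp only [hj, if_neg hxy, if_true] at this
  simp only [count, hj]
  have h0 := h.1
  omega

theorem count_le_count_up (η : Config k N) (x : ↥(bulk N)) : count η ≤ count (up η x) + 1 := by
  by_cases h : ((η x : ℕ) : ℕ∞) < k
  · refine le_trans (Finset.sum_le_sum fun z _ => ?_) (Nat.le_succ _)
    rw [coe_up_apply h]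
    split_ifs with hz
    · subst hz; exact Nat.le_succ _
    · rfl
  · rw [up_eq_self h]; exact Nat.le_succ _

theorem count_le_count_down (η : Config k N) (x : ↥(bulk N)) : count η ≤ count (down η x) + 1 := by
  have := sum_add_eq_sum_add (f := fun z => (down η x z : ℕ)) (g := fun z => (η z : ℕ)) x
    (fun z hz => by simp only [coe_down_apply, if_neg hz])
  simp only [coe_down_apply, if_true] at this
  simp only [count, coe_down_apply]
  omega

/-! ### Effect of the moves on the discrepancy -/

theorem discrepancy_comm (ξ η : Config k N) : discrepancy ξ η = discrepancy η ξ := by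
  simp only [discrepancy, Nat.dist_comm]

theorem discrepancy_up_le (ξ η : Config k N) (x : ↥(bulk N)) :
    discrepancy (up ξ x) η ≤ discrepancy ξ η + 1 := by
  by_cases h : ((ξ x : ℕ) : ℕ∞) < k
  · have := sum_add_eq_sum_add (f := fun z => Nat.dist (up ξ x z) (η z))
      (g := fun z => Nat.dist (ξ z) (η z)) x
      (fun z hz => by simp only [coe_up_apply h, if_neg hz])
    simp only [coe_up_apply h, if_true, Nat.dist] at this
    simp only [discrepancy, coe_up_apply h, Nat.dist]
    omega
  · rw [up_eq_self h]; exact Nat.le_succ _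

theorem discrepancy_down_le (ξ η : Config k N) (x : ↥(bulk N)) :
    discrepancy (down ξ x) η ≤ discrepancy ξ η + 1 := by
  have := sum_add_eq_sum_add (f := fun z => Nat.dist (down ξ x z) (η z))
    (g := fun z => Nat.dist (ξ z) (η z)) x
    (fun z hz => by simp only [coe_down_apply, if_neg hz])
  simp only [coe_down_apply, if_true, Nat.dist] at this
  simp only [discrepancy, coe_down_apply, Nat.dist]
  omega

section Rates

variable {bBulk : Occ k → Occ k → ℝ≥0}

/-- Positive rates mean that neither jump is suppressed, so both configurations are shifted by the
same amount at both sites. -/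
theorem discrepancy_jump_jump
    (hb : ∀ n m, bBulk n m = 0 ↔ (n : ℕ) = 0 ∨ ((m : ℕ) : ℕ∞) = k)
    {ξ η : Config k N} {x y : ↥(bulk N)} (hξ : bBulk (ξ x) (ξ y) ≠ 0)
    (hη : bBulk (η x) (η y) ≠ 0) :
    discrepancy (jump ξ x y) (jump η x y) = discrepancy ξ η := by
  by_cases hxy : x = y
  · subst hxy; rw [jump_self, jump_self]
  rw [Ne, hb] at hξ hη
  push Not at hξ hη
  refine Finset.sum_congr rfl fun z _ => ?_
  rw [coe_jump_apply hxy hξ.1 hξ.2, coe_jump_apply hxy hη.1 hη.2]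
  have h1 := hξ.1
  have h2 := hη.1
  unfold Nat.dist
  by_cases hzy : z = y
  · subst hzy; simp only [if_true]; omega
  · by_cases hzx : z = x
    · subst hzx; simp only [if_neg hzy, if_true]; omega
    · simp only [if_neg hzy, if_neg hzx]

/-- Attractiveness. If `ξ` jumps at a strictly larger rate, then by monotonicity it has more
particles than `η` at `x` or fewer at `y`. The jump reduces the distance by one at such a site and
increases it by at most one at the other. -/
theorem discrepancy_jump_le (hm : ∀ m, Monotone fun n => bBulk n m)
    (ha : ∀ n, Antitone fun m => bBulk n m)
    (hb : ∀ n m, bBulk n m = 0 ↔ (n : ℕ) = 0 ∨ ((m : ℕ) : ℕ∞) = k)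
    {ξ η : Config k N} {x y : ↥(bulk N)} (h : bBulk (η x) (η y) < bBulk (ξ x) (ξ y)) :
    discrepancy (jump ξ x y) η ≤ discrepancy ξ η := by
  by_cases hxy : x = y
  · subst hxy; rw [jump_self]
  have hξ : bBulk (ξ x) (ξ y) ≠ 0 := (pos_of_gt h).ne'
  rw [Ne, hb] at hξ
  push Not at hξ
  have hlt : (η x : ℕ) < ξ x ∨ (ξ y : ℕ) < η y := by
    by_contra hcon
    push Not at hcon
    have h1 : ξ x ≤ η x := hcon.1
    have h2 : η y ≤ ξ y := hcon.2
    exact absurd ((hm (ξ y) h1).trans (ha (η x) h2)) (not_le.mpr h)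
  have hj := coe_jump_apply hxy hξ.1 hξ.2
  have := sum_add_add_eq_sum_add_add (f := fun z => Nat.dist (jump ξ x y z) (η z))
    (g := fun z => Nat.dist (ξ z) (η z)) hxy
    (fun z h1 h2 => by simp only [hj, if_neg h1, if_neg h2])
  simp only [hj, if_neg hxy, if_true, Nat.dist] at this
  simp only [discrepancy, hj, Nat.dist]
  have h0 := hξ.1
  omega

end Rates

/-! ### Generators as finite sums over moves -/

/-- The generator of a process with finitely many possible moves. -/
def moveGen {ι : Type*} [Fintype ι] (rate : ι → Config k N → ℝ≥0)
    (act : ι → Config k N → Config k N) (f : Config k N → ℝ) (η : Config k N) : ℝ :=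
  ∑ i, (rate i η : ℝ) * (f (act i η) - f η)

section MoveGen

variable {ι : Type*} [Fintype ι] {rate : ι → Config k N → ℝ≥0}
  {act : ι → Config k N → Config k N}

/-- A move loses at most one particle, so `b` can be reached only from configurations with at most
one particle more, which are finitely many. Thus the generator applied to an indicator is bounded
even if the rates are not. -/
theorem finite_support_moveGen (hact : ∀ i η, count η ≤ count (act i η) + 1) (b : Config k N) :
    (Function.support (moveGen rate act (pointIndicator b))).Finite := by
  refine (finite_setOf_count_le (count b + 1)).subset fun η hη => ?_
  by_contra hcon
  have hcon' : count b + 1 < count η := not_le.mp hcon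
  refine hη (Finset.sum_eq_zero fun i _ => ?_)
  rw [pointIndicator_of_ne, pointIndicator_of_ne, sub_zero, mul_zero]
  · rintro rfl; omega
  · intro h
    have := hact i η
    rw [h] at this
    omega

theorem moveGen_nonneg {a b : Config k N} (hab : a ≠ b) :
    0 ≤ moveGen rate act (pointIndicator b) a := by
  refine Finset.sum_nonneg fun i _ => mul_nonneg (NNReal.coe_nonneg _) ?_
  rw [pointIndicator_of_ne hab, sub_zero]
  exact indicator_nonneg (fun _ _ => zero_le_one) _

theorem neg_le_moveGen {b : Config k N} {q : ℝ≥0} (hq : ∑ i, rate i b ≤ q) :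
    -(q : ℝ) ≤ moveGen rate act (pointIndicator b) b := by
  have h1 : -(∑ i, (rate i b : ℝ)) ≤ moveGen rate act (pointIndicator b) b := by
    rw [moveGen, ← Finset.sum_neg_distrib]
    refine Finset.sum_le_sum fun i _ => ?_
    rw [pointIndicator_self]
    have h2 : 0 ≤ pointIndicator b (act i b) := indicator_nonneg (fun _ _ => zero_le_one) _
    have h3 := mul_nonneg (NNReal.coe_nonneg (rate i b)) h2
    linarith
  have h2 : (∑ i, (rate i b : ℝ)) ≤ q := by exact_mod_cast hq
  linarith

end MoveGen

section Generators

variable (p : ℤ → ℤ → ℝ≥0) (bBulk : Occ k → Occ k → ℝ≥0) (bIn : ℤ → Occ k → ℝ≥0)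
  (bOut : Occ k → ℤ → ℝ≥0) (θ : ℝ≥0)

/-- The rate of jumps between two sites of the bulk. -/
def bulkRate (e : ↥(bulk N) × ↥(bulk N)) (η : Config k N) : ℝ≥0 :=
  p e.1 e.2 * bBulk (η e.1) (η e.2)

/-- The rate of arrivals from outside of the bulk. -/
def inRate (y : ↥(bulk N)) (η : Config k N) : ℝ≥0 :=
  ∑' x : {x : ℤ // x ∉ bulk N}, p x y * bIn x (η y)

/-- The rate of departures out of the bulk. -/
def outRate (x : ↥(bulk N)) (η : Config k N) : ℝ≥0 :=
  ∑' y : {y : ℤ // y ∉ bulk N}, p x y * bOut (η x) y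

/-- The rates of the moves of the process with reservoirs. -/
def reservoirRate :
    (↥(bulk N) × ↥(bulk N)) ⊕ (↥(bulk N) ⊕ ↥(bulk N)) → Config k N → ℝ≥0 :=
  Sum.elim (bulkRate p bBulk)
    (Sum.elim (fun y η => θ * inRate p bIn y η) (fun x η => θ * outRate p bOut x η))

/-- The moves of the process with impermeable boundaries. -/
def bulkMove (e : ↥(bulk N) × ↥(bulk N)) (η : Config k N) : Config k N := jump η e.1 e.2

/-- The moves of the process with reservoirs. -/
def reservoirMove :
    (↥(bulk N) × ↥(bulk N)) ⊕ (↥(bulk N) ⊕ ↥(bulk N)) → Config k N → Config k N :=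
  Sum.elim bulkMove (Sum.elim (fun y η => up η y) (fun x η => down η x))

theorem bulkGen_eq_moveGen :
    (bulkGen p bBulk : (Config k N → ℝ) → Config k N → ℝ) =
      moveGen (bulkRate p bBulk) bulkMove := by
  ext f η
  simp only [bulkGen, moveGen, Fintype.sum_prod_type, bulkRate, bulkMove, NNReal.coe_mul]

variable {p}

theorem summable_of_boundarySum_ne_top (h : boundarySum p N ≠ ∞) (x : ↥(bulk N)) :
    (Summable fun y : {y : ℤ // y ∉ bulk N} => p x y) ∧
      Summable fun y : {y : ℤ // y ∉ bulk N} => p y x := by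
  have h1 := (ENNReal.sum_ne_top.mp h) x (Finset.mem_univ _)
  rw [ENNReal.tsum_add, ENNReal.add_ne_top] at h1
  exact ⟨ENNReal.tsum_coe_ne_top_iff_summable.mp h1.1,
    ENNReal.tsum_coe_ne_top_iff_summable.mp h1.2⟩

variable {bIn bOut}

theorem summable_inRate (h : boundarySum p N ≠ ∞) {C : ℝ≥0} (hC : ∀ x n, bIn x n ≤ C)
    (y : ↥(bulk N)) (n : Occ k) :
    Summable fun x : {x : ℤ // x ∉ bulk N} => p x y * bIn x n :=
  NNReal.summable_of_le (fun _ => mul_le_mul_right (hC _ _) _)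
    ((summable_of_boundarySum_ne_top h y).2.mul_right C)

theorem summable_outRate (h : boundarySum p N ≠ ∞) {C : ℝ≥0} (hC : ∀ n y, bOut n y ≤ C)
    (x : ↥(bulk N)) (n : Occ k) :
    Summable fun y : {y : ℤ // y ∉ bulk N} => p x y * bOut n y :=
  NNReal.summable_of_le (fun _ => mul_le_mul_right (hC _ _) _)
    ((summable_of_boundarySum_ne_top h x).1.mul_right C)

theorem reservoirGen_eq_moveGen (h : boundarySum p N ≠ ∞) {C : ℝ≥0} (hIn : ∀ x n, bIn x n ≤ C)
    (hOut : ∀ n y, bOut n y ≤ C) :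
    (reservoirGen p bBulk bIn bOut θ : (Config k N → ℝ) → Config k N → ℝ) =
      moveGen (reservoirRate p bBulk bIn bOut θ) reservoirMove := by
  ext f η
  rw [reservoirGen, bulkGen_eq_moveGen, moveGen, moveGen, Fintype.sum_sum_type,
    Fintype.sum_sum_type]
  simp only [reservoirRate, reservoirMove, Sum.elim_inl, Sum.elim_inr, NNReal.coe_mul]
  rw [mul_add, influxGen, outfluxGen]
  have h1 : ∀ y : ↥(bulk N), HasSum (fun x : {x : ℤ // x ∉ bulk N} =>
      (p x y : ℝ) * bIn x (η y) * (f (up η y) - f η))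
      ((inRate p bIn y η : ℝ) * (f (up η y) - f η)) := by
    intro y
    have := (NNReal.hasSum_coe.mpr (summable_inRate h hIn y (η y)).hasSum)
    have h3 := this.mul_right (f (up η y) - f η)
    simp only [NNReal.coe_mul] at h3
    exact h3
  have h2 : ∀ x : ↥(bulk N), HasSum (fun y : {y : ℤ // y ∉ bulk N} =>
      (p x y : ℝ) * bOut (η x) y * (f (down η x) - f η))
      ((outRate p bOut x η : ℝ) * (f (down η x) - f η)) := by
    intro x
    have := (NNReal.hasSum_coe.mpr (summable_outRate h hOut x (η x)).hasSum)
    have h3 := this.mul_right (f (down η x) - f η)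
    simp only [NNReal.coe_mul] at h3
    exact h3
  rw [(hasSum_sum fun y _ => h1 y).tsum_eq, Finset.sum_congr rfl fun x _ => (h2 x).tsum_eq,
    Finset.mul_sum, Finset.mul_sum]
  simp only [mul_assoc]

theorem sum_inRate_add_sum_outRate_le (h : boundarySum p N ≠ ∞) {C : ℝ≥0}
    (hIn : ∀ x n, bIn x n ≤ C) (hOut : ∀ n y, bOut n y ≤ C) (η : Config k N) :
    ((∑ y, inRate p bIn y η + ∑ x, outRate p bOut x η : ℝ≥0) : ℝ≥0∞) ≤ C * boundarySum p N := by
  rw [← Finset.sum_add_distrib, ENNReal.ofNNReal_finsetSum, boundarySum, Finset.mul_sum]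
  refine Finset.sum_le_sum fun x _ => ?_
  rw [ENNReal.coe_add, inRate, outRate, ENNReal.coe_tsum (summable_inRate h hIn x _),
    ENNReal.coe_tsum (summable_outRate h hOut x _), ← ENNReal.tsum_add, ← ENNReal.tsum_mul_left]
  refine ENNReal.tsum_le_tsum fun y => ?_
  rw [mul_add, add_comm]
  refine add_le_add ?_ ?_
  · rw [← ENNReal.coe_mul, ENNReal.coe_le_coe, mul_comm]
    exact mul_le_mul_left (hOut _ _) _
  · rw [← ENNReal.coe_mul, ENNReal.coe_le_coe, mul_comm]
    exact mul_le_mul_left (hIn _ _) _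

theorem count_le_count_bulkMove (e : ↥(bulk N) × ↥(bulk N)) (η : Config k N) :
    count η ≤ count (bulkMove e η) + 1 := by
  rw [bulkMove, count_jump]; exact Nat.le_succ _

theorem count_le_count_reservoirMove (i : (↥(bulk N) × ↥(bulk N)) ⊕ (↥(bulk N) ⊕ ↥(bulk N)))
    (η : Config k N) : count η ≤ count (reservoirMove i η) + 1 := by
  rcases i with e | y | x
  · exact count_le_count_bulkMove e η
  · exact count_le_count_up η y
  · exact count_le_count_down η x

end Generators

/-! ### Laws on the grid -/

section GridLaw

variable {Ω : Type*} [MeasurableSpace Ω] {P : Measure Ω} {X : ℝ≥0 → Ω → Config k N}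
  {L : (Config k N → ℝ) → Config k N → ℝ}

/-- The process as a random path. -/
def IsProcessWithGenerator.path (hX : IsProcessWithGenerator P L X) (ω : Ω) : ConfigPath k N :=
  ⟨fun t => X t ω, hX.cadlag ω⟩

theorem IsProcessWithGenerator.measurable_path (hX : IsProcessWithGenerator P L X) :
    Measurable hX.path :=
  (measurable_pi_lambda _ hX.measurable).subtype_mk

theorem gridValues_succ (h : ℝ≥0) (n : ℕ) (x : ℝ≥0 → Config k N) :
    gridValues h (n + 1) x =
      Fin.snoc (α := fun _ => Config k N) (gridValues h n x) (x (n * h + h)) := by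
  funext i
  refine Fin.lastCases ?_ (fun j => ?_) i
  · rw [Fin.snoc_last]
    simp only [gridValues, Fin.val_last]
    congr 1
    push_cast
    ring
  · rw [Fin.snoc_castSucc]
    rfl

/-- The time step of the discrete chain corresponding to at most one jump of a clock of rate `q`
during a time `h`. -/
def chainStep (q h : ℝ≥0) : ℝ≥0 := h / (1 + q * h)

/-- The probability that a clock of rate `q` rings at most once during a time `h`. -/
def singleJumpProb (q h : ℝ≥0) : ℝ≥0∞ :=
  ENNReal.ofReal (Real.exp (-(q * h)) * (1 + q * h))

/-- The one-step probabilities of the chain with generator `L` and time step `ε`. -/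
def stepWeight (L : (Config k N → ℝ) → Config k N → ℝ) (ε : ℝ≥0) (a b : Config k N) : ℝ≥0∞ :=
  ENNReal.ofReal (pointIndicator b a + ε * L (pointIndicator b) a)

/-- The values on the grid up to time `n h` form an event of the past, to which the one-step bound
applies directly. No Markov property or uniqueness for the martingale problem is invoked. -/
theorem IsProcessWithGenerator.measure_gridValues_succ_ge [IsProbabilityMeasure P]
    {ι : Type*} [Fintype ι] {rate : ι → Config k N → ℝ≥0} {act : ι → Config k N → Config k N}
    (hX : IsProcessWithGenerator P (moveGen rate act) X)
    (hact : ∀ i η, count η ≤ count (act i η) + 1) {q : ℝ≥0} {K : Set (Config k N)}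
    (hq : ∀ a ∈ K, ∑ i, rate i a ≤ q) (h : ℝ≥0) (n : ℕ) (a : Fin (n + 1) → Config k N)
    (b : Config k N) (ha : a (Fin.last n) ∈ K) (hb : b ∈ K) :
    singleJumpProb q h * stepWeight (moveGen rate act) (chainStep q h) (a (Fin.last n)) b *
        P {ω | gridValues h n (fun t => X t ω) = a} ≤
      P {ω | gridValues h (n + 1) (fun t => X t ω) = Fin.snoc (α := fun _ => Config k N) a b} := by
  have hA : MeasurableSet[hX.filtration (n * h)] {ω | gridValues h n (fun t => X t ω) = a} := by
    have : {ω | gridValues h n (fun t => X t ω) = a} =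
        ⋂ i : Fin (n + 1), {ω | X ((i : ℕ) * h) ω = a i} := by
      ext ω
      simp only [mem_ofPred_eq, mem_iInter, funext_iff, gridValues]
    rw [this]
    refine MeasurableSet.iInter fun i => ?_
    have hle : ((i : ℕ) : ℝ≥0) * h ≤ n * h :=
      mul_le_mul_left (by exact_mod_cast Nat.lt_succ_iff.mp i.2) h
    have h1 : MeasurableSet[MeasurableSpace.comap (X ((i : ℕ) * h)) inferInstance]
        {ω | X ((i : ℕ) * h) ω = a i} := ⟨{a i}, measurableSet_singleton _, rfl⟩
    exact (le_iSup₂_of_le (f := fun j (_ : j ≤ n * h) =>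
      MeasurableSpace.comap (X j) inferInstance) _ hle le_rfl) _ h1
  have hmain := hX.measure_inter_ge (a := a (Fin.last n)) (b := b) (q := q) (h := h)
    (finite_support_moveGen hact _) (finite_support_moveGen hact _)
    (fun x hx => moveGen_nonneg hx) (fun x hx => moveGen_nonneg hx) q.2
    (neg_le_moveGen (hq _ ha)) (neg_le_moveGen (hq _ hb)) hA (fun ω hω => by
      have := congrFun hω (Fin.last n)
      simpa [gridValues] using this)
  rw [ENNReal.ofReal_mul (by positivity)] at hmain
  have e1 : (chainStep q h : ℝ) = h / (1 + q * h) := by simp [chainStep]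
  rw [singleJumpProb, stepWeight, e1]
  refine hmain.trans (le_of_eq ?_)
  congr 1
  ext ω
  simp only [mem_inter_iff, mem_ofPred_eq, gridValues_succ, Fin.snoc_inj]

end GridLaw

theorem measure_le_of_singleton_le {A : Type*} [MeasurableSpace A] [Countable A]
    [DiscreteMeasurableSpace A] {μ ν : Measure A} (h : ∀ a, μ {a} ≤ ν {a}) : μ ≤ ν := by
  refine Measure.le_iff.mpr fun S hS => ?_
  rw [← lintegral_indicator_one hS, ← lintegral_indicator_one hS, lintegral_countable',
    lintegral_countable']
  exact ENNReal.tsum_le_tsum fun a => mul_le_mul_right (h a) _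

/-! ### The coupling of the two processes -/

section Coupling

/-- States of the coupled chain: a configuration of the process with reservoirs, a configuration of
the process with impermeable boundaries, and the number of moves of the reservoirs so far. -/
abbrev CoupledState (k : ℕ∞) (N : ℕ) : Type := Config k N × Config k N × ℕ

/-- The moves of the coupled chain: common jumps, jumps of only one of the two components,
arrivals and departures. -/
abbrev CoupledMove (N : ℕ) : Type :=
  (↥(bulk N) × ↥(bulk N)) ⊕ ((↥(bulk N) × ↥(bulk N)) ⊕ ((↥(bulk N) × ↥(bulk N)) ⊕
    (↥(bulk N) ⊕ ↥(bulk N))))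

variable (p : ℤ → ℤ → ℝ≥0) (bBulk : Occ k → Occ k → ℝ≥0) (bIn : ℤ → Occ k → ℝ≥0)
  (bOut : Occ k → ℤ → ℝ≥0) (θ : ℝ≥0) (G : CoupledState k N → Prop)

open Classical in
/-- The rates of the moves of the basic coupling, which is stopped outside of `G`. -/
def coupledRate (j : CoupledMove N) (z : CoupledState k N) : ℝ≥0 :=
  if G z then
    Sum.elim (fun e => p e.1 e.2 * min (bBulk (z.1 e.1) (z.1 e.2)) (bBulk (z.2.1 e.1) (z.2.1 e.2)))
      (Sum.elim
        (fun e => p e.1 e.2 * (bBulk (z.1 e.1) (z.1 e.2) - bBulk (z.2.1 e.1) (z.2.1 e.2)))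
      (Sum.elim
        (fun e => p e.1 e.2 * (bBulk (z.2.1 e.1) (z.2.1 e.2) - bBulk (z.1 e.1) (z.1 e.2)))
      (Sum.elim (fun y => θ * inRate p bIn y z.1) (fun x => θ * outRate p bOut x z.1)))) j
  else 0

/-- The effect of the moves of the coupled chain. -/
def coupledAct (j : CoupledMove N) (z : CoupledState k N) : CoupledState k N :=
  Sum.elim (fun e => (jump z.1 e.1 e.2, jump z.2.1 e.1 e.2, z.2.2))
    (Sum.elim (fun e => (jump z.1 e.1 e.2, z.2.1, z.2.2))
    (Sum.elim (fun e => (z.1, jump z.2.1 e.1 e.2, z.2.2))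
    (Sum.elim (fun y => (up z.1 y, z.2.1, z.2.2 + 1)) (fun x => (down z.1 x, z.2.1, z.2.2 + 1))))) j

variable {p bBulk bIn bOut θ G}

theorem coupledRate_of_not {z : CoupledState k N} (hz : ¬ G z) (j : CoupledMove N) :
    coupledRate p bBulk bIn bOut θ G j z = 0 := if_neg hz

theorem coe_min_add_coe_tsub (a b : ℝ≥0) : ((min a b : ℝ≥0) : ℝ) + ((a - b : ℝ≥0) : ℝ) = a := by
  rw [← NNReal.coe_add, add_comm, tsub_add_min]

/-- Common and solitary jumps add up to the correct rate because `min a b + (a - b) = a` with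
truncated subtraction. -/
theorem sum_coupledRate_fst {z : CoupledState k N} (hz : G z) (f : Config k N → ℝ) :
    ∑ j, (coupledRate p bBulk bIn bOut θ G j z : ℝ) * (f (coupledAct j z).1 - f z.1) =
      moveGen (reservoirRate p bBulk bIn bOut θ) reservoirMove f z.1 := by
  simp only [moveGen, coupledRate, if_pos hz, Fintype.sum_sum_type, Sum.elim_inl, Sum.elim_inr,
    coupledAct, reservoirRate, reservoirMove, sub_self, mul_zero, Finset.sum_const_zero, zero_add]
  rw [← add_assoc, ← Finset.sum_add_distrib]
  congr 1
  refine Finset.sum_congr rfl fun e _ => ?_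
  rw [bulkRate, bulkMove, NNReal.coe_mul, NNReal.coe_mul, NNReal.coe_mul,
    ← coe_min_add_coe_tsub (bBulk (z.1 e.1) (z.1 e.2)) (bBulk (z.2.1 e.1) (z.2.1 e.2))]
  ring

theorem sum_coupledRate_snd {z : CoupledState k N} (hz : G z) (f : Config k N → ℝ) :
    ∑ j, (coupledRate p bBulk bIn bOut θ G j z : ℝ) * (f (coupledAct j z).2.1 - f z.2.1) =
      moveGen (bulkRate p bBulk) bulkMove f z.2.1 := by
  simp only [moveGen, coupledRate, if_pos hz, Fintype.sum_sum_type, Sum.elim_inl, Sum.elim_inr,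
    coupledAct, sub_self, mul_zero, Finset.sum_const_zero, zero_add, add_zero]
  rw [← Finset.sum_add_distrib]
  refine Finset.sum_congr rfl fun e _ => ?_
  rw [bulkRate, bulkMove, NNReal.coe_mul, NNReal.coe_mul, NNReal.coe_mul,
    ← coe_min_add_coe_tsub (bBulk (z.2.1 e.1) (z.2.1 e.2)) (bBulk (z.1 e.1) (z.1 e.2)), min_comm]
  ring

theorem sum_coupledRate_le (z : CoupledState k N) :
    ∑ j, coupledRate p bBulk bIn bOut θ G j z ≤
      ∑ i, reservoirRate p bBulk bIn bOut θ i z.1 + ∑ e, bulkRate p bBulk e z.2.1 := by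
  by_cases hz : G z
  · simp only [coupledRate, if_pos hz, Fintype.sum_sum_type, Sum.elim_inl, Sum.elim_inr,
      reservoirRate]
    have h1 : ∀ e : ↥(bulk N) × ↥(bulk N),
        p e.1 e.2 * min (bBulk (z.1 e.1) (z.1 e.2)) (bBulk (z.2.1 e.1) (z.2.1 e.2)) +
          p e.1 e.2 * (bBulk (z.1 e.1) (z.1 e.2) - bBulk (z.2.1 e.1) (z.2.1 e.2)) =
        bulkRate p bBulk e z.1 := by
      intro e
      rw [← mul_add, add_comm, tsub_add_min, bulkRate]
    have h2 : ∀ e : ↥(bulk N) × ↥(bulk N),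
        p e.1 e.2 * (bBulk (z.2.1 e.1) (z.2.1 e.2) - bBulk (z.1 e.1) (z.1 e.2)) ≤
        bulkRate p bBulk e z.2.1 := fun e => mul_le_mul_right tsub_le_self _
    have h3 := Finset.sum_le_sum
      fun e (_ : e ∈ (Finset.univ : Finset (↥(bulk N) × ↥(bulk N)))) => h2 e
    rw [← add_assoc, ← Finset.sum_add_distrib, Finset.sum_congr rfl fun e _ => h1 e]
    calc _ ≤ ∑ e, bulkRate p bBulk e z.1 + (∑ e, bulkRate p bBulk e z.2.1 + _) :=
          add_le_add le_rfl (add_le_add h3 le_rfl)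
      _ = _ := by ring
  · simp [coupledRate_of_not hz]

theorem count_coupledAct (j : CoupledMove N) (z : CoupledState k N) :
    count (coupledAct j z).2.1 = count z.2.1 := by
  rcases j with e | e | e | y | x
  · exact count_jump _ _ _
  · rfl
  · exact count_jump _ _ _
  · rfl
  · rfl

theorem le_coupledAct (j : CoupledMove N) (z : CoupledState k N) :
    z.2.2 ≤ (coupledAct j z).2.2 := by
  rcases j with e | e | e | y | x
  · exact le_rfl
  · exact le_rfl
  · exact le_rfl
  · exact Nat.le_succ _
  · exact Nat.le_succ _

/-- The invariant of the coupling: bulk moves do not increase the discrepancy, while a reservoir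
move increases it by at most one and raises the counter by one, even when it has no effect on the
configuration. -/
theorem discrepancy_coupledAct_le (hm : ∀ m, Monotone fun n => bBulk n m)
    (ha : ∀ n, Antitone fun m => bBulk n m)
    (hb : ∀ n m, bBulk n m = 0 ↔ (n : ℕ) = 0 ∨ ((m : ℕ) : ℕ∞) = k)
    {j : CoupledMove N} {z : CoupledState k N} (hj : coupledRate p bBulk bIn bOut θ G j z ≠ 0)
    (hz : discrepancy z.1 z.2.1 ≤ z.2.2) :
    discrepancy (coupledAct j z).1 (coupledAct j z).2.1 ≤ (coupledAct j z).2.2 := by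
  have hG : G z := by
    by_contra h
    exact hj (coupledRate_of_not h j)
  simp only [coupledRate, if_pos hG] at hj
  rcases j with e | e | e | y | x
  · have h1 := right_ne_zero_of_mul hj
    have h2 := pos_iff_ne_zero.mpr h1
    rw [lt_min_iff] at h2
    refine le_trans (le_of_eq ?_) hz
    exact discrepancy_jump_jump hb h2.1.ne' h2.2.ne'
  · have h1 := right_ne_zero_of_mul hj
    exact (discrepancy_jump_le hm ha hb (tsub_pos_iff_lt.mp (pos_iff_ne_zero.mpr h1))).trans hz
  · have h1 := right_ne_zero_of_mul hj
    change discrepancy z.1 (jump z.2.1 e.1 e.2) ≤ z.2.2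
    rw [discrepancy_comm] at hz ⊢
    exact (discrepancy_jump_le hm ha hb (tsub_pos_iff_lt.mp (pos_iff_ne_zero.mpr h1))).trans hz
  · exact (discrepancy_up_le _ _ _).trans (Nat.succ_le_succ hz)
  · exact (discrepancy_down_le _ _ _).trans (Nat.succ_le_succ hz)

/-- Exponential moments of the number of moves of the reservoirs. -/
theorem lintegral_pow_coupled_le (h : boundarySum p N ≠ ∞) {C : ℝ≥0} (hIn : ∀ x n, bIn x n ≤ C)
    (hOut : ∀ n y, bOut n y ≤ C) {ε : ℝ≥0} {z : CoupledState k N}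
    (hε : ε * ∑ j, coupledRate p bBulk bIn bOut θ G j z ≤ 1) (v : ℝ≥0) :
    ∫⁻ w, ((1 + v : ℝ≥0) : ℝ≥0∞) ^ w.2.2
        ∂moveKernel (coupledRate p bBulk bIn bOut θ G) coupledAct ε z ≤
      (1 + ε * (θ * (C * boundarySum p N)) * v) * ((1 + v : ℝ≥0) : ℝ≥0∞) ^ z.2.2 := by
  -- The increments of `(1 + v) ^ z.2.2`: zero for bulk moves, and `v` times the current value for
  -- moves of the reservoirs.
  let d : CoupledMove N → ℝ≥0∞ := Sum.elim 0 (Sum.elim 0 (Sum.elim 0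
    fun _ => v * ((1 + v : ℝ≥0) : ℝ≥0∞) ^ z.2.2))
  refine (lintegral_moveKernel_le hε d fun j _ => ?_).trans ?_
  · have hs : ((1 + v : ℝ≥0) : ℝ≥0∞) ^ (z.2.2 + 1) =
        ((1 + v : ℝ≥0) : ℝ≥0∞) ^ z.2.2 + v * ((1 + v : ℝ≥0) : ℝ≥0∞) ^ z.2.2 := by
      rw [pow_succ, ENNReal.coe_add, ENNReal.coe_one]; ring
    rcases j with e | e | e | y | x
    · exact le_self_add
    · exact le_self_add
    · exact le_self_add
    · exact hs.le
    · exact hs.le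
  · rw [add_mul, one_mul]
    refine add_le_add le_rfl ?_
    simp only [Fintype.sum_sum_type, d, Sum.elim_inl, Sum.elim_inr, Pi.zero_apply, mul_zero,
      Finset.sum_const_zero, zero_add]
    rw [← Finset.sum_mul, ← Finset.sum_mul, ← add_mul, ← mul_assoc]
    refine mul_le_mul_left (mul_le_mul_left ?_ _) _
    rw [← ENNReal.ofNNReal_finsetSum, ← ENNReal.ofNNReal_finsetSum, ← ENNReal.coe_add,
      ← Finset.mul_sum, ← Finset.mul_sum, ← mul_add, ENNReal.coe_mul]
    refine mul_le_mul_right ?_ _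
    by_cases hG : G z
    · simp only [coupledRate, if_pos hG, Sum.elim_inr, Sum.elim_inl]
      rw [← Finset.mul_sum, ← Finset.mul_sum, ← mul_add, ENNReal.coe_mul]
      exact mul_le_mul_right (sum_inRate_add_sum_outRate_le h hIn hOut z.1) _
    · simp [coupledRate_of_not hG]

end Coupling

theorem chainStep_mul_le_one (q h : ℝ≥0) : chainStep q h * q ≤ 1 := by
  rw [chainStep, div_mul_eq_mul_div]
  exact div_le_one_of_le₀ (by rw [mul_comm]; exact le_add_self) (by positivity)

theorem singleJumpProb_le_one (q h : ℝ≥0) : singleJumpProb q h ≤ 1 := by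
  rw [singleJumpProb, ← ENNReal.ofReal_one]
  refine ENNReal.ofReal_le_ofReal ?_
  have h1 := Real.add_one_le_exp ((q : ℝ) * h)
  have h2 : Real.exp (-(q * h : ℝ)) * Real.exp (q * h) = 1 := by
    rw [← Real.exp_add]; simp
  have h3 := mul_le_mul_of_nonneg_left h1 (Real.exp_pos (-(q * h : ℝ))).le
  rw [h2] at h3
  linarith

/-- Provides the clock rate `q`, which depends on the particle bound `M` without any control. This
is harmless, as the grid is chosen after `q`. -/
theorem exists_rate_bound {ι ι' : Type*} [Fintype ι] [Fintype ι'] (r : ι → Config k N → ℝ≥0)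
    (r' : ι' → Config k N → ℝ≥0) (M : ℕ) :
    ∃ q : ℝ≥0, ∀ a b, count a ≤ M → count b ≤ M → ∑ i, r i a + ∑ i, r' i b ≤ q := by
  obtain ⟨q₁, h₁⟩ := ((finite_setOf_count_le (k := k) (N := N) M).image
    fun a => ∑ i, r i a).bddAbove
  obtain ⟨q₂, h₂⟩ := ((finite_setOf_count_le (k := k) (N := N) M).image
    fun a => ∑ i, r' i a).bddAbove
  exact ⟨q₁ + q₂, fun a b ha hb => add_le_add (h₁ ⟨a, ha, rfl⟩) (h₂ ⟨b, hb, rfl⟩)⟩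

section Coupling

variable {p : ℤ → ℤ → ℝ≥0} {bBulk : Occ k → Occ k → ℝ≥0} {bIn : ℤ → Occ k → ℝ≥0}
  {bOut : Occ k → ℤ → ℝ≥0} {θ : ℝ≥0}

/-- The set of states in which the coupled chain follows both generators. -/
def goodStates (M : ℕ) (z : CoupledState k N) : Prop :=
  z.2.2 < N ∧ count z.2.1 ≤ M ∧ count z.1 ≤ M + N

/-- The initial distribution of the coupled chain. -/
def diagonalLaw (ρ : Measure (Config k N)) : Measure (CoupledState k N) :=
  ρ.map fun η => (η, η, 0)

theorem measure_gridValues_zero {Ω : Type*} [MeasurableSpace Ω] {P : Measure Ω}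
    {X : ℝ≥0 → Ω → Config k N} (hX : ∀ t, Measurable (X t)) (h : ℝ≥0)
    (pr : CoupledState k N → Config k N) (hpr : ∀ η, pr (η, η, 0) = η)
    (a : Fin 1 → Config k N) :
    diagonalLaw (P.map (X 0)) {z | (fun _ => pr z) = a} =
      P {ω | gridValues h 0 (fun t => X t ω) = a} := by
  rw [diagonalLaw, Measure.map_apply Measurable.of_discrete MeasurableSet.of_discrete,
    Measure.map_apply (hX 0) MeasurableSet.of_discrete]
  congr 1
  ext ω
  simp only [mem_preimage, mem_ofPred_eq, hpr, gridValues, funext_iff, Fin.forall_fin_one]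
  simp

/-- The chain of the basic coupling of the two processes. -/
def coupledChain (p : ℤ → ℤ → ℝ≥0) (bBulk : Occ k → Occ k → ℝ≥0) (bIn : ℤ → Occ k → ℝ≥0)
    (bOut : Occ k → ℤ → ℝ≥0) (θ : ℝ≥0) (M : ℕ) (ε : ℝ≥0) (ρ : Measure (Config k N)) (n : ℕ) :
    Measure (Fin (n + 1) → CoupledState k N) :=
  chainLaw (moveKernel (coupledRate p bBulk bIn bOut θ (goodStates M)) coupledAct ε)
    (diagonalLaw ρ) n

variable {M : ℕ} {q h : ℝ≥0} {ρ : Measure (Config k N)}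

theorem chainStep_mul_sum_coupledRate_le
    (hq : ∀ a b : Config k N, count a ≤ M + N → count b ≤ M + N →
      ∑ i, reservoirRate p bBulk bIn bOut θ i a + ∑ e, bulkRate p bBulk e b ≤ q)
    (z : CoupledState k N) :
    chainStep q h * ∑ j, coupledRate p bBulk bIn bOut θ (goodStates M) j z ≤ 1 := by
  by_cases hz : goodStates M z
  · refine le_trans (mul_le_mul_right ?_ _) (chainStep_mul_le_one q h)
    exact (sum_coupledRate_le z).trans (hq _ _ hz.2.2 (hz.2.1.trans (Nat.le_add_right _ _)))
  · simp [coupledRate_of_not hz]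

theorem coupledChain_univ [IsProbabilityMeasure ρ]
    (hq : ∀ a b : Config k N, count a ≤ M + N → count b ≤ M + N →
      ∑ i, reservoirRate p bBulk bIn bOut θ i a + ∑ e, bulkRate p bBulk e b ≤ q) (n : ℕ) :
    coupledChain p bBulk bIn bOut θ M (chainStep q h) ρ n univ = 1 := by
  have : IsProbabilityMeasure (diagonalLaw ρ) :=
    Measure.isProbabilityMeasure_map Measurable.of_discrete.aemeasurable
  refine chainLaw_univ _ _ (fun z => ?_) n
  have := lintegral_ofReal_moveKernel (act := coupledAct) (f := fun _ => 1)
    (fun _ => zero_le_one) (chainStep_mul_sum_coupledRate_le (h := h) hq z)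
  simpa using this

/-- As the counter is non-decreasing, its final value bounds the discrepancy at all grid times at
once, so no maximal inequality is required. -/
theorem ae_coupledChain (hm : ∀ m, Monotone fun n => bBulk n m)
    (ha : ∀ n, Antitone fun m => bBulk n m)
    (hb : ∀ n m, bBulk n m = 0 ↔ (n : ℕ) = 0 ∨ ((m : ℕ) : ℕ∞) = k) (ε : ℝ≥0) (n : ℕ) :
    ∀ᵐ p ∂coupledChain p bBulk bIn bOut θ M ε ρ n, ∀ i,
      discrepancy (p i).1 (p i).2.1 ≤ (p i).2.2 ∧ (p i).2.2 ≤ (p (Fin.last n)).2.2 := by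
  refine ae_chainLaw _ _ (Q := fun n (p : Fin (n + 1) → CoupledState k N) => ∀ i,
    discrepancy (p i).1 (p i).2.1 ≤ (p i).2.2 ∧ (p i).2.2 ≤ (p (Fin.last n)).2.2) ?_ ?_ n
  · refine (ae_map_iff Measurable.of_discrete.aemeasurable MeasurableSet.of_discrete).mpr
      (Eventually.of_forall fun η i => ⟨?_, le_rfl⟩)
    simp [discrepancy_self]
  · intro n p hp
    refine (ae_moveKernel (Q := fun z : CoupledState k N => discrepancy z.1 z.2.1 ≤ z.2.2 ∧
      (p (Fin.last n)).2.2 ≤ z.2.2) ⟨(hp _).1, le_rfl⟩ fun j hj =>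
        ⟨discrepancy_coupledAct_le hm ha hb hj (hp _).1, le_coupledAct _ _⟩).mono fun z hz i => ?_
    rw [Fin.snoc_last]
    refine Fin.lastCases ?_ (fun i => ?_) i
    · rw [Fin.snoc_last]; exact ⟨hz.1, le_rfl⟩
    · rw [Fin.snoc_castSucc]; exact ⟨(hp i).1, (hp i).2.trans hz.2⟩

/-- The second component, with impermeable boundaries, conserves the number of particles. -/
theorem coupledChain_count_gt_le (ε : ℝ≥0)
    (hε : ∀ z : CoupledState k N, ε * ∑ j, coupledRate p bBulk bIn bOut θ (goodStates M) j z ≤ 1)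
    (n : ℕ) :
    coupledChain p bBulk bIn bOut θ M ε ρ n {p | M < count (p (Fin.last n)).2.1} ≤
      ρ {η | M < count η} := by
  let F : CoupledState k N → ℝ≥0∞ := indicator {z | M < count z.2.1} 1
  have h1 := lintegral_last_chainLaw_le
    (moveKernel (coupledRate p bBulk bIn bOut θ (goodStates M)) coupledAct ε) (diagonalLaw ρ)
    (F := F) (c := 1) (fun z => ?_) n
  · rw [one_pow, one_mul] at h1
    have e1 : ∫⁻ z, F z ∂diagonalLaw ρ = ρ {η | M < count η} := by
      rw [lintegral_indicator_one MeasurableSet.of_discrete, diagonalLaw,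
        Measure.map_apply Measurable.of_discrete MeasurableSet.of_discrete]
      rfl
    rw [e1] at h1
    refine le_trans (le_of_eq ?_) h1
    rw [← lintegral_indicator_one MeasurableSet.of_discrete]
    rfl
  · refine (lintegral_moveKernel_le (hε z) 0 fun j _ => ?_).trans (by simp)
    rw [Pi.zero_apply, add_zero]
    simp only [F, indicator_apply, mem_ofPred_eq, count_coupledAct, Pi.one_apply, le_refl]

/-- Markov's inequality for `(1 + v)` to the power of the counter, whose expectation grows by a
fixed factor in each step. -/
theorem coupledChain_le_counter (hS : boundarySum p N ≠ ∞) {C : ℝ≥0}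
    (hIn : ∀ x n, bIn x n ≤ C) (hOut : ∀ n y, bOut n y ≤ C) [IsProbabilityMeasure ρ] (ε : ℝ≥0)
    (hε : ∀ z : CoupledState k N, ε * ∑ j, coupledRate p bBulk bIn bOut θ (goodStates M) j z ≤ 1)
    (v : ℝ≥0) (D n : ℕ) :
    coupledChain p bBulk bIn bOut θ M ε ρ n {p | D ≤ (p (Fin.last n)).2.2} ≤
      (1 + ε * (θ * (C * boundarySum p N)) * v) ^ n / ((1 + v : ℝ≥0) : ℝ≥0∞) ^ D := by
  have h1 := lintegral_last_chainLaw_le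
    (moveKernel (coupledRate p bBulk bIn bOut θ (goodStates M)) coupledAct ε) (diagonalLaw ρ)
    (F := fun w => ((1 + v : ℝ≥0) : ℝ≥0∞) ^ w.2.2)
    (fun z => lintegral_pow_coupled_le hS hIn hOut (hε z) v) n
  have e1 : ∫⁻ z, ((1 + v : ℝ≥0) : ℝ≥0∞) ^ z.2.2 ∂diagonalLaw ρ = 1 := by
    rw [diagonalLaw, lintegral_map Measurable.of_discrete Measurable.of_discrete]
    simp
  rw [e1, mul_one] at h1
  have hv0 : ((1 + v : ℝ≥0) : ℝ≥0∞) ^ D ≠ 0 :=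
    pow_ne_zero _ (by exact_mod_cast (by positivity : (0 : ℝ≥0) < 1 + v).ne')
  have hvt : ((1 + v : ℝ≥0) : ℝ≥0∞) ^ D ≠ ∞ := ENNReal.pow_ne_top ENNReal.coe_ne_top
  rw [ENNReal.le_div_iff_mul_le (Or.inl hv0) (Or.inl hvt), mul_comm]
  refine le_trans ?_ h1
  refine le_trans (mul_le_mul_right (measure_mono fun p hp => ?_) _)
    (mul_meas_ge_le_lintegral (Measurable.of_discrete
      (f := fun p : Fin (n + 1) → CoupledState k N =>
        ((1 + v : ℝ≥0) : ℝ≥0∞) ^ (p (Fin.last n)).2.2)) _)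
  have hv1 : (1 : ℝ≥0∞) ≤ ((1 + v : ℝ≥0) : ℝ≥0∞) := by
    exact_mod_cast (le_self_add : (1 : ℝ≥0) ≤ 1 + v)
  exact pow_le_pow_right₀ hv1 hp

end Coupling

section Paths

variable {p : ℤ → ℤ → ℝ≥0} {bBulk : Occ k → Occ k → ℝ≥0} {bIn : ℤ → Occ k → ℝ≥0}
  {bOut : Occ k → ℤ → ℝ≥0} {θ : ℝ≥0}
  {Ω₁ : Type*} [MeasurableSpace Ω₁] {P₁ : Measure Ω₁} [IsProbabilityMeasure P₁]
  {X : ℝ≥0 → Ω₁ → Config k N}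
  {Ω₂ : Type*} [MeasurableSpace Ω₂] {P₂ : Measure Ω₂} [IsProbabilityMeasure P₂]
  {Y : ℝ≥0 → Ω₂ → Config k N}

/-- A coupling of the two processes for which the discrepancy on a grid is controlled. -/
theorem exists_path_coupling (hm : ∀ m, Monotone fun n => bBulk n m)
    (ha : ∀ n, Antitone fun m => bBulk n m)
    (hb : ∀ n m, bBulk n m = 0 ↔ (n : ℕ) = 0 ∨ ((m : ℕ) : ℕ∞) = k)
    (hS : boundarySum p N ≠ ∞) {C : ℝ≥0} (hIn : ∀ x n, bIn x n ≤ C) (hOut : ∀ n y, bOut n y ≤ C)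
    (hX : IsProcessWithGenerator P₁ (bulkGen p bBulk) X)
    (hY : IsProcessWithGenerator P₂ (reservoirGen p bBulk bIn bOut θ) Y)
    (hinit : P₁.map (X 0) = P₂.map (Y 0)) {M : ℕ} {q : ℝ≥0}
    (hq : ∀ a b : Config k N, count a ≤ M + N → count b ≤ M + N →
      ∑ i, reservoirRate p bBulk bIn bOut θ i a + ∑ e, bulkRate p bBulk e b ≤ q)
    (h : ℝ≥0) (n : ℕ) :
    ∃ R : Measure (ConfigPath k N × ConfigPath k N),
      R.map Prod.fst = P₂.map hY.path ∧ R.map Prod.snd = P₁.map hX.path ∧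
      ∀ D ≤ N, ∀ v : ℝ≥0, R {e | ∃ i, D < discrepancy (gridValues h n e.1.1 i)
          (gridValues h n e.2.1 i)} ≤
        2 * ((1 + chainStep q h * (θ * (C * boundarySum p N)) * v) ^ n /
          ((1 + v : ℝ≥0) : ℝ≥0∞) ^ D) + P₁ {ω | M < count (X 0 ω)} +
          (1 - singleJumpProb q h ^ n) := by
  set ε := chainStep q h
  set c := singleJumpProb q h
  set ρ := P₁.map (X 0) with hρ
  have : IsProbabilityMeasure ρ := Measure.isProbabilityMeasure_map (hX.measurable 0).aemeasurable
  have : IsProbabilityMeasure (P₁.map hX.path) :=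
    Measure.isProbabilityMeasure_map hX.measurable_path.aemeasurable
  have : IsProbabilityMeasure (P₂.map hY.path) :=
    Measure.isProbabilityMeasure_map hY.measurable_path.aemeasurable
  have hε : ∀ z : CoupledState k N,
      ε * ∑ j, coupledRate p bBulk bIn bOut θ (goodStates M) j z ≤ 1 :=
    chainStep_mul_sum_coupledRate_le hq
  have hX' := hX
  have hY' := hY
  rw [bulkGen_eq_moveGen] at hX'
  rw [reservoirGen_eq_moveGen bBulk θ hS hIn hOut] at hY'
  set chain := coupledChain p bBulk bIn bOut θ M ε ρ n with hchain
  set good : Set (Fin (n + 1) → CoupledState k N) := {p | goodStates M (p (Fin.last n))} with hgood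
  have hfrozen : ∀ z : CoupledState k N, ¬ goodStates M z →
      ∀ᵐ w ∂moveKernel (coupledRate p bBulk bIn bOut θ (goodStates M)) coupledAct ε z,
        ¬ goodStates M w := fun z hz =>
    ae_moveKernel (Q := fun w => ¬ goodStates M w) hz
      fun j hj => absurd (coupledRate_of_not hz j) hj
  -- The one-step law of a projection of the chain, in the form in which the marginal generators
  -- appear as `stepWeight`.
  have hkernel : ∀ (pr : CoupledState k N → Config k N) (b : Config k N) (z : CoupledState k N),
      moveKernel (coupledRate p bBulk bIn bOut θ (goodStates M)) coupledAct ε z {z' | pr z' = b} =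
      ENNReal.ofReal (pointIndicator b (pr z) + ε * ∑ j, coupledRate p bBulk bIn bOut θ
        (goodStates M) j z *
          (pointIndicator b (pr (coupledAct j z)) - pointIndicator b (pr z))) := by
    intro pr b z
    rw [← lintegral_ofReal_moveKernel (f := fun z => pointIndicator b (pr z))
      (fun _ => indicator_nonneg (fun _ _ => zero_le_one) _) (hε z),
      ← lintegral_indicator_one MeasurableSet.of_discrete]
    refine lintegral_congr fun w => ?_
    by_cases hw : pr w = b
    · simp [hw, pointIndicator_self]
    · simp [hw, pointIndicator_of_ne]
  have hYle := pow_mul_chainLaw_le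
    (moveKernel (coupledRate p bBulk bIn bOut θ (goodStates M)) coupledAct ε) (diagonalLaw ρ)
    (pr := fun z => z.1) (G := goodStates M) (K := {a : Config k N | count a ≤ M + N})
    (fun z hz => hz.2.2) hfrozen
    (w := stepWeight (moveGen (reservoirRate p bBulk bIn bOut θ) reservoirMove) ε)
    (fun z hz b => by
      rw [hkernel (fun z => z.1), stepWeight, sum_coupledRate_fst hz (pointIndicator b)])
    (c := c) (ν := fun n a => P₂ {ω | gridValues h n (fun t => Y t ω) = a})
    (fun a => by
      rw [hinit, measure_gridValues_zero hY.measurable h (fun z => z.1) (fun _ => rfl)])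
    (fun n a b h1 h2 => hY'.measure_gridValues_succ_ge count_le_count_reservoirMove
      (fun a ha => le_self_add.trans (hq a a ha ha)) h n a b h1 h2) n
  have hXle := pow_mul_chainLaw_le
    (moveKernel (coupledRate p bBulk bIn bOut θ (goodStates M)) coupledAct ε) (diagonalLaw ρ)
    (pr := fun z => z.2.1) (G := goodStates M) (K := {a : Config k N | count a ≤ M + N})
    (fun z hz => hz.2.1.trans (Nat.le_add_right _ _)) hfrozen
    (w := stepWeight (moveGen (bulkRate p bBulk) bulkMove) ε)
    (fun z hz b => by
      rw [hkernel (fun z => z.2.1), stepWeight, sum_coupledRate_snd hz (pointIndicator b)])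
    (c := c) (ν := fun n a => P₁ {ω | gridValues h n (fun t => X t ω) = a})
    (fun a => by
      rw [hρ, measure_gridValues_zero hX.measurable h (fun z => z.2.1) (fun _ => rfl)])
    (fun n a b h1 h2 => hX'.measure_gridValues_succ_ge count_le_count_bulkMove
      (fun a ha => le_add_self.trans (hq a a ha ha)) h n a b h1 h2) n
  set proj : (Fin (n + 1) → CoupledState k N) →
      (Fin (n + 1) → Config k N) × (Fin (n + 1) → Config k N) :=
    fun p => (fun i => (p i).1, fun i => (p i).2.1) with hproj
  -- The sub-coupling: trajectories that end, hence almost surely remain, in the good set, weighted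
  -- by the probability of at most one ring of the clock in each time step.
  set γ := c ^ n • (chain.restrict good).map proj with hγ
  have hγapply : ∀ S, γ S = c ^ n * chain (proj ⁻¹' S ∩ good) := by
    intro S
    rw [hγ, Measure.smul_apply, smul_eq_mul,
      Measure.map_apply Measurable.of_discrete MeasurableSet.of_discrete,
      Measure.restrict_apply MeasurableSet.of_discrete]
  have hgv : Measurable fun x : ConfigPath k N => gridValues h n x.1 := measurable_gridValues h n
  have h₁ : γ.map Prod.fst ≤ (P₂.map hY.path).map fun x => gridValues h n x.1 := by
    refine measure_le_of_singleton_le fun a => ?_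
    rw [Measure.map_apply measurable_fst (measurableSet_singleton a), hγapply,
      Measure.map_apply hgv (measurableSet_singleton a),
      Measure.map_apply hY.measurable_path (hgv (measurableSet_singleton a))]
    exact hYle a
  have h₂ : γ.map Prod.snd ≤ (P₁.map hX.path).map fun x => gridValues h n x.1 := by
    refine measure_le_of_singleton_le fun a => ?_
    rw [Measure.map_apply measurable_snd (measurableSet_singleton a), hγapply,
      Measure.map_apply hgv (measurableSet_singleton a),
      Measure.map_apply hX.measurable_path (hgv (measurableSet_singleton a))]
    exact hXle a
  obtain ⟨R, hR₁, hR₂, hR⟩ := exists_coupling_of_discrete _ _ hgv hgv h₁ h₂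
  refine ⟨R, hR₁, hR₂, fun D hD v => ?_⟩
  have hc1 : c ^ n ≤ 1 := pow_le_one₀ bot_le (singleJumpProb_le_one q h)
  have hinv := ae_coupledChain (ρ := ρ) (p := p) (bIn := bIn) (bOut := bOut) (θ := θ) (M := M)
    hm ha hb ε n
  set t := (1 + ε * (θ * (C * boundarySum p N)) * v) ^ n / ((1 + v : ℝ≥0) : ℝ≥0∞) ^ D with ht
  have hcount : chain {p | D ≤ (p (Fin.last n)).2.2} ≤ t :=
    coupledChain_le_counter hS hIn hOut ε hε v D n
  have hinit' : chain {p | M < count (p (Fin.last n)).2.1} ≤ P₁ {ω | M < count (X 0 ω)} := by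
    refine (coupledChain_count_gt_le ε hε n).trans (le_of_eq ?_)
    rw [hρ, Measure.map_apply (hX.measurable 0) MeasurableSet.of_discrete]
    rfl
  set S : Set ((Fin (n + 1) → Config k N) × (Fin (n + 1) → Config k N)) :=
    {a | ∃ i, D < discrepancy (a.1 i) (a.2 i)}
  have hγS : γ S ≤ t := by
    rw [hγapply]
    refine (mul_le_of_le_one_left bot_le hc1).trans (le_trans ?_ hcount)
    refine measure_mono_ae ?_
    filter_upwards [hinv] with p hp hpS
    obtain ⟨i, hi⟩ := hpS.1
    exact (hi.le.trans (hp i).1).trans (hp i).2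
  -- With the counter below `D ≤ N` and at most `M` particles in the second component, the first has
  -- at most `M + N` particles, so the third condition of `goodStates` is automatic.
  have hbad : chain goodᶜ ≤ t + P₁ {ω | M < count (X 0 ω)} := by
    refine le_trans (le_trans (measure_mono_ae (t := {p | D ≤ (p (Fin.last n)).2.2} ∪
      {p | M < count (p (Fin.last n)).2.1}) ?_) (measure_union_le _ _))
      (add_le_add hcount hinit')
    filter_upwards [hinv] with p hp hpS
    by_contra hcon'
    have hcon : ¬ (D ≤ (p (Fin.last n)).2.2 ∨ M < count (p (Fin.last n)).2.1) := hcon'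
    rw [not_or, not_le, not_lt] at hcon
    refine hpS ⟨hcon.1.trans_le hD, hcon.2, ?_⟩
    have h3 := count_le_count_add_discrepancy (p (Fin.last n)).1 (p (Fin.last n)).2.1
    have h4 := (hp (Fin.last n)).1
    have h5 := hcon.1
    have h6 := hcon.2
    omega
  -- The term `t` enters a second time here, through the escape from the good set; hence the factor
  -- `2` in the bound.
  have hγu : 1 - γ univ ≤ t + P₁ {ω | M < count (X 0 ω)} + (1 - c ^ n) := by
    rw [tsub_le_iff_right, hγapply, preimage_univ, univ_inter]
    have h7 : chain good + chain goodᶜ = 1 := by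
      rw [measure_add_measure_compl MeasurableSet.of_discrete]
      exact coupledChain_univ hq n
    calc (1 : ℝ≥0∞) = c ^ n + (1 - c ^ n) := (add_tsub_cancel_of_le hc1).symm
      _ = c ^ n * chain good + c ^ n * chain goodᶜ + (1 - c ^ n) := by
          rw [← mul_add, h7, mul_one]
      _ ≤ c ^ n * chain good + (t + P₁ {ω | M < count (X 0 ω)}) + (1 - c ^ n) :=
          add_le_add (add_le_add le_rfl ((mul_le_of_le_one_left bot_le hc1).trans hbad)) le_rfl
      _ = _ := by ring
  refine (hR S).trans ((add_le_add hγS hγu).trans (le_of_eq ?_))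
  ring

end Paths

/-! ### Exponential closeness -/

theorem coe_gridStep {T : ℝ} (hT : 0 < T) (κ : ℝ≥0) (n : ℕ) : (gridStep κ T n : ℝ) = κ * T / n := by
  simp [gridStep, hT.le]

/-- With `x = q κ T / n`, one has `exp (-x) (1 + x) ≥ 1 - x ^ 2`, and Bernoulli's inequality leaves
an error `n x ^ 2` of order `1 / n`. -/
theorem tendsto_one_sub_singleJumpProb_pow {T : ℝ} (hT : 0 < T) (κ q : ℝ≥0) :
    Tendsto (fun n => 1 - singleJumpProb q (gridStep κ T n) ^ n) atTop (𝓝 0) := by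
  have hlim : Tendsto (fun n : ℕ => ENNReal.ofReal ((q * (κ * T)) ^ 2 / n)) atTop (𝓝 0) := by
    have := ENNReal.tendsto_ofReal (tendsto_const_div_atTop_nhds_zero_nat ((q * (κ * T) : ℝ) ^ 2))
    simpa using this
  refine tendsto_of_tendsto_of_tendsto_of_le_of_le' tendsto_const_nhds hlim
    (Eventually.of_forall fun _ => bot_le) ?_
  have hsmall := (tendsto_const_div_atTop_nhds_zero_nat (q * (κ * T) : ℝ)).eventually_le_const
    (u := 1) one_pos
  filter_upwards [hsmall, eventually_gt_atTop 0] with n hn hn0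
  have hn0' : (0 : ℝ) < n := Nat.cast_pos.mpr hn0
  have ex : (q : ℝ) * gridStep κ T n = q * (κ * T) / n := by rw [coe_gridStep hT]; ring
  rw [singleJumpProb, ex]
  set x : ℝ := q * (κ * T) / n with hx
  have hx0 : 0 ≤ x := by positivity
  have h1 : 1 + -(x ^ 2) ≤ Real.exp (-x) * (1 + x) := by
    have := Real.add_one_le_exp (-x)
    nlinarith
  have h2 : 1 - n * x ^ 2 ≤ (Real.exp (-x) * (1 + x)) ^ n := by
    have h3 := one_add_mul_le_pow (a := -(x ^ 2)) (by nlinarith) n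
    have h4 := pow_le_pow_left₀ (by nlinarith) h1 n
    linarith
  rw [← ENNReal.ofReal_pow (by positivity), ← ENNReal.ofReal_one,
    ← ENNReal.ofReal_sub _ (by positivity)]
  refine ENNReal.ofReal_le_ofReal ?_
  have h5 : n * x ^ 2 = (q * (κ * T)) ^ 2 / n := by
    rw [hx]; field_simp
  linarith

theorem exists_measure_count_gt_lt {Ω : Type*} [MeasurableSpace Ω] {P : Measure Ω}
    [IsProbabilityMeasure P] {X : Ω → Config k N} (hX : Measurable X) {δ : ℝ≥0∞} (hδ : 0 < δ) :
    ∃ M, P {ω | M < count (X ω)} < δ := by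
  have h := tendsto_measure_of_ae_tendsto_indicator_of_isFiniteMeasure (μ := P) (L := atTop)
    (A := ∅) MeasurableSet.empty (As := fun M => {ω | M < count (X ω)})
    (fun M => hX (MeasurableSet.of_discrete (s := {η | M < count η})))
    (Eventually.of_forall fun ω => by
      filter_upwards [eventually_ge_atTop (count (X ω))] with M hM
      exact iff_of_false (not_lt.mpr hM) (notMem_empty _))
  rw [measure_empty] at h
  exact (h.eventually_lt_const hδ).exists

/-- The chain step is at most `κ T / n`, and there are `n` steps. The bound involves neither `q` nor
`n`, which is why these may be taken as large as the approximation requires. -/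
theorem one_add_chainStep_pow_le {T : ℝ} (hT : 0 < T) (κ q θ C v : ℝ≥0) {S : ℝ≥0∞} {b : ℝ}
    (hb : 0 ≤ b) (hS : (κ : ℝ≥0∞) * θ * S ≤ ENNReal.ofReal b) {n : ℕ} (hn : 0 < n) :
    (1 + chainStep q (gridStep κ T n) * (θ * (C * S)) * v) ^ n ≤
      ENNReal.ofReal (Real.exp (T * C * b * v)) := by
  have hn0 : (0 : ℝ) < n := Nat.cast_pos.mpr hn
  have h1 : (chainStep q (gridStep κ T n) : ℝ≥0∞) ≤ κ * ENNReal.ofReal (T / n) := by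
    have h2 : chainStep q (gridStep κ T n) ≤ gridStep κ T n :=
      div_le_self bot_le le_self_add
    refine (ENNReal.coe_le_coe.mpr h2).trans (le_of_eq ?_)
    rw [← ENNReal.ofReal_coe_nnreal, ← ENNReal.ofReal_coe_nnreal (p := κ),
      ← ENNReal.ofReal_mul (NNReal.coe_nonneg κ), coe_gridStep hT, mul_div_assoc]
  have h3 : (chainStep q (gridStep κ T n) : ℝ≥0∞) * (θ * (C * S)) * v ≤
      ENNReal.ofReal (T * C * b * v / n) := by
    calc _ ≤ κ * ENNReal.ofReal (T / n) * (θ * (C * S)) * v :=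
          mul_le_mul_left (mul_le_mul_left h1 _) _
      _ = ENNReal.ofReal (T / n) * C * (κ * θ * S) * v := by ring
      _ ≤ ENNReal.ofReal (T / n) * C * ENNReal.ofReal b * v :=
          mul_le_mul_left (mul_le_mul_right hS _) _
      _ = _ := by
        rw [← ENNReal.ofReal_coe_nnreal (p := C), ← ENNReal.ofReal_coe_nnreal (p := v),
          ← ENNReal.ofReal_mul (by positivity), ← ENNReal.ofReal_mul (by positivity),
          ← ENNReal.ofReal_mul (by positivity)]
        congr 1
        ring
  refine (pow_le_pow_left₀ bot_le (add_le_add le_rfl h3) n).trans ?_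
  rw [← ENNReal.ofReal_one, ← ENNReal.ofReal_add zero_le_one (by positivity),
    ← ENNReal.ofReal_pow (by positivity)]
  refine ENNReal.ofReal_le_ofReal ?_
  have h4 : Real.exp (T * C * b * v) = Real.exp (T * C * b * v / n) ^ n := by
    rw [← Real.exp_nat_mul]
    congr 1
    field_simp
  rw [h4]
  refine pow_le_pow_left₀ (by positivity) ?_ n
  rw [add_comm]
  exact Real.add_one_le_exp _

section Paths

variable {p : ℤ → ℤ → ℝ≥0} {bBulk : Occ k → Occ k → ℝ≥0} {bIn : ℤ → Occ k → ℝ≥0}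
  {bOut : Occ k → ℤ → ℝ≥0} {θ : ℝ≥0}
  {Ω₁ : Type*} [MeasurableSpace Ω₁] {P₁ : Measure Ω₁} [IsProbabilityMeasure P₁]
  {X : ℝ≥0 → Ω₁ → Config k N}
  {Ω₂ : Type*} [MeasurableSpace Ω₂] {P₂ : Measure Ω₂} [IsProbabilityMeasure P₂]
  {Y : ℝ≥0 → Ω₂ → Config k N}

/-- A coupling of the two processes for which the Skorokhod distance of the empirical paths is
controlled by exponential moments of the number of moves of the reservoirs. -/
theorem exists_skorokhod_coupling (hm : ∀ m, Monotone fun n => bBulk n m)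
    (ha : ∀ n, Antitone fun m => bBulk n m)
    (hb : ∀ n m, bBulk n m = 0 ↔ (n : ℕ) = 0 ∨ ((m : ℕ) : ℕ∞) = k)
    {C : ℝ≥0} (hIn : ∀ x n, bIn x n ≤ C) (hOut : ∀ n y, bOut n y ≤ C) {κ : ℝ≥0}
    (hκ : 0 < κ) (hθ : 0 < θ)
    (hX : IsProcessWithGenerator P₁ (bulkGen p bBulk) X)
    (hY : IsProcessWithGenerator P₂ (reservoirGen p bBulk bIn bOut θ) Y)
    (hinit : P₁.map (X 0) = P₂.map (Y 0)) {T : ℝ} (hT : 0 < T) {α β : ℝ≥0∞} (hα : 0 < α)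
    (hβ : 0 < β) :
    ∃ R : Measure (ConfigPath k N × ConfigPath k N),
      R.map Prod.fst = P₂.map hY.path ∧ R.map Prod.snd = P₁.map hX.path ∧
      ∀ b : ℝ, 0 ≤ b → (κ : ℝ≥0∞) * θ * boundarySum p N ≤ ENNReal.ofReal b →
        ∀ D ≤ N, ∀ v : ℝ≥0,
        R {e | α + (((N - 1 : ℕ) : ℝ≥0)⁻¹ : ℝ≥0) * (D : ℝ≥0∞) + α <
          edist (toEmpirical κ T e.1) (toEmpirical κ T e.2)} ≤
        2 * (ENNReal.ofReal (Real.exp (T * C * b * v)) / ((1 + v : ℝ≥0) : ℝ≥0∞) ^ D) + 4 * β := by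
  have hp1 : IsProbabilityMeasure (P₁.map hX.path) :=
    Measure.isProbabilityMeasure_map hX.measurable_path.aemeasurable
  have hp2 : IsProbabilityMeasure (P₂.map hY.path) :=
    Measure.isProbabilityMeasure_map hY.measurable_path.aemeasurable
  -- In this case no finite `b` is admissible and any coupling will do.
  by_cases hS : boundarySum p N = ∞
  · refine ⟨(P₂.map hY.path).prod (P₁.map hX.path), by simp, by simp, fun b _ hle => ?_⟩
    rw [hS, ENNReal.mul_top (by simp [hκ.ne', hθ.ne']), top_le_iff] at hle
    exact absurd hle ENNReal.ofReal_ne_top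
  -- The order of the choices matters: first the particle bound `M`, then the rate `q` on the
  -- configurations it allows, and finally the grid size `n`.
  obtain ⟨M, hM⟩ := exists_measure_count_gt_lt (P := P₁) (hX.measurable 0) hβ
  obtain ⟨q, hq⟩ := exists_rate_bound (reservoirRate p bBulk bIn bOut θ)
    (bulkRate (N := N) p bBulk) (M + N)
  obtain ⟨n, hn0, hn1, hnY, hnX⟩ := ((eventually_gt_atTop 0).and
    (((tendsto_one_sub_singleJumpProb_pow hT κ q).eventually_lt_const hβ).and
    ((eventually_measure_edist_stepPath_lt hT κ (P₂.map hY.path) hα hβ).and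
    (eventually_measure_edist_stepPath_lt hT κ (P₁.map hX.path) hα hβ)))).exists
  obtain ⟨R, hR₂, hR₁, hR⟩ := exists_path_coupling hm ha hb hS hIn hOut hX hY hinit hq
    (gridStep κ T n) n
  refine ⟨R, hR₂, hR₁, fun b hb0 hle D hD v => ?_⟩
  set step : ConfigPath k N → PathSpace T :=
    fun x => stepPath T n (gridValues (gridStep κ T n) n x.1) with hstep
  set B : Set (ConfigPath k N) := {x | α ≤ edist (toEmpirical κ T x) (step x)} with hB
  have hBm : MeasurableSet B :=
    measurableSet_le measurable_const (measurable_edist_toEmpirical_stepPath hT κ n)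
  have hsub : {e : ConfigPath k N × ConfigPath k N |
      α + (((N - 1 : ℕ) : ℝ≥0)⁻¹ : ℝ≥0) * (D : ℝ≥0∞) + α <
        edist (toEmpirical κ T e.1) (toEmpirical κ T e.2)} ⊆
      ({e | ∃ i, D < discrepancy (gridValues (gridStep κ T n) n e.1.1 i)
          (gridValues (gridStep κ T n) n e.2.1 i)} ∪ Prod.fst ⁻¹' B) ∪ Prod.snd ⁻¹' B := by
    intro e he
    by_contra hcon
    rw [mem_union, mem_union, not_or, not_or] at hcon
    obtain ⟨⟨h1, h2⟩, h3⟩ := hcon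
    have h1' : ∀ i, discrepancy (gridValues (gridStep κ T n) n e.1.1 i)
        (gridValues (gridStep κ T n) n e.2.1 i) ≤ D := fun i => not_lt.mp fun h => h1 ⟨i, h⟩
    have h2' : edist (toEmpirical κ T e.1) (step e.1) ≤ α := (not_le.mp h2).le
    have h3' : edist (step e.2) (toEmpirical κ T e.2) ≤ α := by
      rw [edist_comm]; exact (not_le.mp h3).le
    have he' : α + (((N - 1 : ℕ) : ℝ≥0)⁻¹ : ℝ≥0) * (D : ℝ≥0∞) + α <
        edist (toEmpirical κ T e.1) (toEmpirical κ T e.2) := he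
    refine absurd he' (not_lt.mpr ?_)
    refine (edist_triangle4 _ (step e.1) (step e.2) _).trans ?_
    exact add_le_add (add_le_add h2' (edist_stepPath_le T n _ _ h1')) h3'
  refine (measure_mono hsub).trans ((measure_union_le _ _).trans
    (add_le_add (measure_union_le _ _) le_rfl)|>.trans ?_)
  rw [← Measure.map_apply measurable_fst hBm, ← Measure.map_apply measurable_snd hBm, hR₁, hR₂]
  have hpow := one_add_chainStep_pow_le hT κ q θ C v hb0 hle hn0
  -- The four errors `β` are the initial number of particles, the multiple rings of the clock, and
  -- the discretization of each of the two paths.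
  calc _ ≤ 2 * (ENNReal.ofReal (Real.exp (T * C * b * v)) / ((1 + v : ℝ≥0) : ℝ≥0∞) ^ D) + β + β +
        β + β := by
        refine add_le_add (add_le_add ((hR D hD v).trans ?_) hnY.le) hnX.le
        exact add_le_add (add_le_add
          (mul_le_mul_right (ENNReal.div_le_div_right hpow _) _) hM.le) hn1.le
    _ = _ := by ring

end Paths

theorem eventually_exp_bound (K c : ℝ) :
    ∀ᶠ N : ℕ in atTop, c * Real.exp (-((K + 1) * N)) + 4 * Real.exp (-((N : ℝ) ^ 2)) ≤
      Real.exp (-(K * N)) := by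
  filter_upwards [eventually_ge_atTop ⌈K + 1⌉₊, eventually_ge_atTop ⌈|c| + 4⌉₊] with N h1 h2
  have h1' : K + 1 ≤ N := Nat.ceil_le.mp h1
  have h2' : |c| + 4 ≤ N := Nat.ceil_le.mp h2
  -- Of the spare factor `exp (-N)`, a part absorbs the constants `|c| + 4`; the Gaussian term is
  -- negligible once `N ≥ K + 1`.
  have hN : (0 : ℝ) ≤ N := Nat.cast_nonneg N
  have e1 : Real.exp (-((N : ℝ) ^ 2)) ≤ Real.exp (-((K + 1) * N)) :=
    Real.exp_le_exp.mpr (by nlinarith)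
  have e2 : Real.exp (-((K + 1) * N)) = Real.exp (-(K * N)) * Real.exp (-(N : ℝ)) := by
    rw [← Real.exp_add]; congr 1; ring
  have e3 : (|c| + 4) * Real.exp (-(N : ℝ)) ≤ 1 := by
    rw [Real.exp_neg, ← div_eq_mul_inv, div_le_one (Real.exp_pos _)]
    have := Real.add_one_le_exp (N : ℝ)
    linarith
  have hpos := Real.exp_pos (-((K + 1) * (N : ℝ)))
  have hpos' := Real.exp_pos (-(K * (N : ℝ)))
  calc _ ≤ (|c| + 4) * Real.exp (-((K + 1) * N)) := by
        have := mul_le_mul_of_nonneg_right (le_abs_self c) hpos.le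
        linarith
    _ = Real.exp (-(K * N)) * ((|c| + 4) * Real.exp (-(N : ℝ))) := by rw [e2]; ring
    _ ≤ _ := mul_le_of_le_one_right hpos'.le e3

theorem limsup_inv_mul_log_eq_bot {u : ℕ → ℝ≥0∞}
    (h : ∀ K : ℝ, ∀ᶠ N : ℕ in atTop, u N ≤ ENNReal.ofReal (Real.exp (-(K * N)))) :
    limsup (fun N : ℕ => (((N : ℝ)⁻¹ : ℝ) : EReal) * ENNReal.log (u N)) atTop = ⊥ := by
  rw [EReal.eq_bot_iff_forall_lt]
  intro y
  refine lt_of_le_of_lt (limsup_le_of_le (by isBoundedDefault) (a := ((y - 1 : ℝ) : EReal)) ?_)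
    (by exact_mod_cast sub_one_lt y)
  filter_upwards [h (-(y - 1)), eventually_gt_atTop 0] with N hN hN0
  have hN' : (0 : ℝ) < N := Nat.cast_pos.mpr hN0
  have h1 : ENNReal.log (u N) ≤ (((y - 1) * N : ℝ) : EReal) := by
    refine (ENNReal.log_le_log hN).trans (le_of_eq ?_)
    rw [ENNReal.log_ofReal, if_neg (not_le.mpr (Real.exp_pos _)), Real.log_exp]
    congr 1
    ring
  calc _ ≤ (((N : ℝ)⁻¹ : ℝ) : EReal) * (((y - 1) * N : ℝ) : EReal) :=
        mul_le_mul_of_nonneg_left h1 (by exact_mod_cast (inv_pos.mpr hN').le)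
    _ = _ := by
        rw [← EReal.coe_mul]
        congr 1
        field_simp

end Misanthrope

end

/-! ### Conclusion: choice of the constants -/

theorem theorem2
    (k : ℕ∞)
    -- the jump kernel and the rates
    (p : ℤ → ℤ → ℝ≥0)
    (bBulk : Occ k → Occ k → ℝ≥0)
    (bBulk_mono : ∀ m, Monotone fun n => bBulk n m)
    (bBulk_anti : ∀ n, Antitone fun m => bBulk n m)
    (bBulk_zero : ∀ n m, bBulk n m = 0 ↔ (n : ℕ) = 0 ∨ ((m : ℕ) : ℕ∞) = k)
    (bIn : ℤ → Occ k → ℝ≥0) (bIn_bdd : ∃ C, ∀ x n, bIn x n ≤ C)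
    (bOut : Occ k → ℤ → ℝ≥0) (bOut_bdd : ∃ C, ∀ n y, bOut n y ≤ C)
    -- the speed-up and the strength of the reservoirs
    (κ θ : ℕ → ℝ≥0) (hκ : ∀ N, 0 < κ N) (hθ : ∀ N, 0 < θ N)
    (hθ_zero : Tendsto θ atTop (𝓝 0))
    (hsmall : Tendsto (fun N : ℕ => (κ N : ℝ≥0∞) * (θ N : ℝ≥0∞) * boundarySum p N / (N : ℝ≥0∞))
      atTop (𝓝 0))
    (T : ℝ) (hT : 0 < T)
    -- the process with impermeable boundaries
    {Ω₁ : ℕ → Type*} [∀ N, MeasurableSpace (Ω₁ N)] (P₁ : ∀ N, Measure (Ω₁ N))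
    [∀ N, IsProbabilityMeasure (P₁ N)] (X : ∀ N, ℝ≥0 → Ω₁ N → Config k N)
    (hX : ∀ N, IsProcessWithGenerator (P₁ N) (bulkGen p bBulk) (X N))
    -- the process in contact with weak reservoirs
    {Ω₂ : ℕ → Type*} [∀ N, MeasurableSpace (Ω₂ N)] (P₂ : ∀ N, Measure (Ω₂ N))
    [∀ N, IsProbabilityMeasure (P₂ N)] (Y : ∀ N, ℝ≥0 → Ω₂ N → Config k N)
    (hY : ∀ N, IsProcessWithGenerator (P₂ N) (reservoirGen p bBulk bIn bOut (θ N)) (Y N))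
    -- both start from the same distribution
    (hinit : ∀ N, (P₁ N).map (X N 0) = (P₂ N).map (Y N 0)) :
    ExponentiallyEquivalent
      (fun N => empiricalLaw (P₂ N) (κ N) T (Y N) (hY N).cadlag)
      (fun N => empiricalLaw (P₁ N) (κ N) T (X N) (hX N).cadlag) := by
  obtain ⟨C₁, hC₁⟩ := bIn_bdd
  obtain ⟨C₂, hC₂⟩ := bOut_bdd
  set C := max C₁ C₂
  have hIn : ∀ x n, bIn x n ≤ C := fun x n => (hC₁ x n).trans (le_max_left _ _)
  have hOut : ∀ n y, bOut n y ≤ C := fun n y => (hC₂ n y).trans (le_max_right _ _)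
  -- The couplings must not depend on `ε`, so the errors are fixed in advance: `1 / (N + 1)` tends
  -- to zero, and `exp (-N ^ 2)` is superexponentially small.
  have hcoup := fun N => exists_skorokhod_coupling bBulk_mono bBulk_anti bBulk_zero hIn hOut (hκ N)
    (hθ N) (hX N) (hY N) (hinit N) hT (α := ENNReal.ofReal (1 / ((N : ℝ) + 1)))
    (β := ENNReal.ofReal (Real.exp (-((N : ℝ) ^ 2)))) (ENNReal.ofReal_pos.mpr (by positivity))
    (ENNReal.ofReal_pos.mpr (Real.exp_pos _))
  choose R hR₂ hR₁ hR using hcoup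
  have hm : ∀ N, Measurable (toEmpirical (κ N) T : ConfigPath k N → PathSpace T) :=
    fun N => measurable_toEmpirical hT (κ N)
  refine ⟨fun N => ConfigPath k N × ConfigPath k N, fun _ => inferInstance, R,
    fun N e => toEmpirical (κ N) T e.1, fun N e => toEmpirical (κ N) T e.2, fun N => ?_,
    fun N => (hm N).comp measurable_fst, fun N => (hm N).comp measurable_snd, fun N => ?_,
    fun N => ?_, fun ε hε => ⟨fun N => ?_, ?_⟩⟩
  · have : IsProbabilityMeasure ((R N).map Prod.fst) := by
      rw [hR₂]
      exact Measure.isProbabilityMeasure_map (hY N).measurable_path.aemeasurable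
    exact Measure.isProbabilityMeasure_of_map Prod.fst
  · change (R N).map (toEmpirical (κ N) T ∘ Prod.fst) = _
    rw [← Measure.map_map (hm N) measurable_fst, hR₂,
      Measure.map_map (hm N) (hY N).measurable_path]
    rfl
  · change (R N).map (toEmpirical (κ N) T ∘ Prod.snd) = _
    rw [← Measure.map_map (hm N) measurable_snd, hR₁,
      Measure.map_map (hm N) (hX N).measurable_path]
    rfl
  · exact measurableSet_lt measurable_const (measurable_edist_toEmpirical hT (κ N))
  · refine limsup_inv_mul_log_eq_bot fun K => ?_
    -- At most `δ N` discrepancies are tolerated. The bound `1` ensures `D ≤ N`, and `ε / 4` leaves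
    -- room for `N / (N - 1) ≤ 2` and for the two discretization errors.
    set δ : ℝ := min (ε / 4) 1 with hδ
    have hδ0 : 0 < δ := lt_min (by positivity) one_pos
    -- With `1 + v = exp l`, the denominator `(1 + v) ^ D` is about `exp ((|K| + 2) N)`. One unit in
    -- the exponent pays for the exponential moment, and another for the constants.
    set l : ℝ := (|K| + 2) / δ with hl
    have hl0 : 0 < l := by positivity
    set v : ℝ≥0 := (Real.exp l - 1).toNNReal with hv
    have hv' : ((1 + v : ℝ≥0) : ℝ) = Real.exp l := by
      rw [NNReal.coe_add, hv, Real.coe_toNNReal _ (by linarith [Real.add_one_le_exp l])]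
      simp
    set A : ℝ := T * C * v with hA
    have hA0 : 0 ≤ A := by positivity
    have hev := hsmall.eventually_lt_const
      (ENNReal.ofReal_pos.mpr (by positivity : (0 : ℝ) < 1 / (A + 1)))
    filter_upwards [hev, eventually_ge_atTop 2, eventually_ge_atTop ⌈4 / ε⌉₊,
      eventually_exp_bound |K| (2 * Real.exp l)] with N h1 h2 h3 h4
    have hN : (2 : ℝ) ≤ N := by exact_mod_cast h2
    have hN0 : (0 : ℝ) < N := by linarith
    have h3' : 4 / ε ≤ N := Nat.ceil_le.mp h3
    set D : ℕ := ⌊δ * N⌋₊ with hD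
    have hDle : (D : ℝ) ≤ δ * N := Nat.floor_le (by positivity)
    have hDge : δ * N < D + 1 := Nat.lt_floor_add_one _
    have hDN : D ≤ N := by
      have : (D : ℝ) ≤ N := hDle.trans (mul_le_of_le_one_left hN0.le (min_le_right _ _))
      exact_mod_cast this
    -- The `o(N)` hypothesis is used with `b = N / (A + 1)`, chosen so that `T C b v = N A / (A + 1)
    -- ≤ N`.
    have hb : (κ N : ℝ≥0∞) * θ N * boundarySum p N ≤ ENNReal.ofReal (N / (A + 1)) := by
      rw [ENNReal.div_lt_iff (Or.inl (by simp; omega)) (Or.inl (ENNReal.natCast_ne_top N))] at h1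
      refine h1.le.trans (le_of_eq ?_)
      rw [← ENNReal.ofReal_natCast, ← ENNReal.ofReal_mul (by positivity)]
      congr 1
      ring
    have hmain := hR N (N / (A + 1)) (by positivity) hb D hDN v
    refine le_trans (measure_mono fun e he => ?_) (hmain.trans ?_)
    · refine lt_of_le_of_lt ?_ (show ENNReal.ofReal ε < _ from he)
      have e1 : (((N - 1 : ℕ) : ℝ≥0)⁻¹ : ℝ≥0) * (D : ℝ≥0∞) = ENNReal.ofReal (D / (N - 1)) := by
        rw [← ENNReal.ofReal_coe_nnreal, ← ENNReal.ofReal_natCast D,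
          ← ENNReal.ofReal_mul (NNReal.coe_nonneg _)]
        congr 1
        rw [NNReal.coe_inv, NNReal.coe_natCast, Nat.cast_sub (by omega), Nat.cast_one]
        ring
      have hN1 : (0 : ℝ) < N - 1 := by linarith
      rw [e1, ← ENNReal.ofReal_add (by positivity) (by positivity),
        ← ENNReal.ofReal_add (by positivity) (by positivity)]
      refine ENNReal.ofReal_le_ofReal ?_
      have e2 : (D : ℝ) / (N - 1) ≤ ε / 2 := by
        rw [div_le_iff₀ hN1]
        have : δ ≤ ε / 4 := min_le_left _ _
        nlinarith
      have e3 : 1 / ((N : ℝ) + 1) ≤ ε / 4 := by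
        rw [div_le_iff₀ (by positivity)]
        rw [div_le_iff₀ hε] at h3'
        nlinarith
      linarith
    · have e1 : ((1 + v : ℝ≥0) : ℝ≥0∞) ^ D = ENNReal.ofReal (Real.exp (l * D)) := by
        rw [← ENNReal.ofReal_coe_nnreal, hv', ← ENNReal.ofReal_pow (Real.exp_pos _).le,
          ← Real.exp_nat_mul, mul_comm]
      rw [e1, ← ENNReal.ofReal_div_of_pos (Real.exp_pos _), ← Real.exp_sub]
      have e2 : (2 : ℝ≥0∞) = ENNReal.ofReal 2 := by simp
      have e4 : (4 : ℝ≥0∞) = ENNReal.ofReal 4 := by simp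
      rw [e2, e4, ← ENNReal.ofReal_mul (by norm_num), ← ENNReal.ofReal_mul (by norm_num),
        ← ENNReal.ofReal_add (by positivity) (by positivity)]
      refine ENNReal.ofReal_le_ofReal ?_
      have h5 : T * C * (N / (A + 1)) * v ≤ N := by
        have : T * C * (N / (A + 1)) * v = N * (A / (A + 1)) := by rw [hA]; ring
        rw [this]
        exact mul_le_of_le_one_right hN0.le (div_le_one_of_le₀ (by linarith) (by linarith))
      -- Rounding `δ N` down to `D` loses at most `l` in the exponent, that is, the constant factor
      -- `exp l`.
      have h6 : (|K| + 2) * N - l ≤ l * D := by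
        have h7 : l * δ = |K| + 2 := by rw [hl]; field_simp
        have h8 := mul_le_mul_of_nonneg_left hDge.le hl0.le
        rw [← mul_assoc, h7] at h8
        linarith
      have h9 : Real.exp (T * C * (N / (A + 1)) * v - l * D) ≤
          Real.exp l * Real.exp (-((|K| + 1) * N)) := by
        rw [← Real.exp_add]
        exact Real.exp_le_exp.mpr (by linarith)
      have h10 : Real.exp (-(|K| * N)) ≤ Real.exp (-(K * N)) :=
        Real.exp_le_exp.mpr (by nlinarith [le_abs_self K])
      refine le_trans ?_ (h4.trans h10)
      linarith
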